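/- A partial function $F:\subseteq\mathbb{N}^{\mathbb{N}}\to\mathbb{N}^{\mathbb{N}}$ is computable if a single oracle machine computes $F(p)(n)$ from $n$ with oracle $p$, for all $p\in\operatorname{dom}(F)$ and $n\in\mathbb{N}$. A representation of a set $X$ is a surjective partial function $\delta_X:\subseteq\mathbb{N}^{\mathbb{N}}\to X$; if $\delta_X(p)=x$, then $p$ is called a name of $x$. A partial multi-valued function $f:\subseteq X\rightrightarrows Y$ between represented spaces is realized by $F:\subseteq\mathbb{N}^{\mathbb{N}}\to\mathbb{N}^{\mathbb{N}}$, written $F\vdash f$, if $F$ maps every name of every $x\in\operatorname{dom}(f)=\{x: f(x)\neq\emptyset\}$ to a name of some $y\in f(x)$. One writes $f\leq_{\mathrm{sW}}g$ if there are computable $H,K:\subseteq\mathbb{N}^{\mathbb{N}}\to\mathbb{N}^{\mathbb{N}}$ such that $K\circ G\circ H\vdash f$ whenever $G\vdash g$, and $f\equiv_{\mathrm{sW}}g$ (strong Weihrauch equivalence) if $f\leq_{\mathrm{sW}}g$ and $g\leq_{\mathrm{sW}}f$. Fix effective enumerations $\alpha$ of $\mathbb{Q}^n$ (one for each $n$)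 and $(q_m)_m$ of the nonnegative rationals, and a computable pairing function on $\mathbb{N}$. The space $\mathbb{R}^n$ carries the Euclidean metric $d$ and the Cauchy representation: $p$ is a name of $x$ if $d(\alpha(p(i)),\alpha(p(j)))\leq 2^{-i}$ for all $i\leq j$ and $\lim_i\alpha(p(i))=x$. The space $\mathcal{A}_+(\mathbb{R}^n)$ of closed subsets of $\mathbb{R}^n$ carries the positive information representation: a name of $A$ is an enumeration (possibly of the empty set) of exactly those $k=\langle j,m\rangle$ for which the open ball $B(\alpha(j),q_m)$ meets $A$. Finite products and sequence spaces carry the usual representations by pairing of names. Let - $\operatorname{Proj}^+_{\mathbb{R}^n}:\subseteq\mathbb{R}^n\times\mathcal{A}_+(\mathbb{R}^n)\rightrightarrows\mathbb{R}^n$ map $(x,A)$ with $A\neq\emptyset$ to the set of all $y\in A$ with $d(x,y)=\inf_{z\in A}d(x,z)$; - $\operatorname{BWT}_{\mathbb{R}}:\subseteq\mathbb{R}^{\mathbb{N}}\rightrightarrows\mathbb{R}$ map every bounded sequence (equivalently, every sequence whose range has compact closure) to the set of its cluster points. Then, for every $n\geq 2$, $$\operatorname{Proj}^+_{\mathbb{R}^n}\equiv_{\mathrm{sW}}\operatorname{BWT}_{\mathbb{R}}.$$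 -/

import Mathlib

open TopologicalSpace

noncomputable section

/-! ### Computability on Baire space -/

/-- Baire space `ℕ^ℕ`. -/
abbrev Baire : Type := ℕ → ℕ

/-- The partial recursive functionals: `Φ p n` is the result, if any, of running a fixed oracle
program on the number `n` with the infinite sequence `p` as oracle. This is `Nat.RecursiveIn`
uniformly in the oracle: one and the same program serves every `p`. -/
inductive RecursiveFunctional : (Baire → ℕ →. ℕ) → Prop
  | zero : RecursiveFunctional fun _ _ => Part.some 0
  | succ : RecursiveFunctional fun _ n => Part.some (n + 1)
  | left : RecursiveFunctional fun _ n => Part.some n.unpair.1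
  | right : RecursiveFunctional fun _ n => Part.some n.unpair.2
  | oracle : RecursiveFunctional fun p n => Part.some (p n)
  | pair {Φ Ψ : Baire → ℕ →. ℕ} (hΦ : RecursiveFunctional Φ) (hΨ : RecursiveFunctional Ψ) :
      RecursiveFunctional fun p n => Nat.pair <$> Φ p n <*> Ψ p n
  | comp {Φ Ψ : Baire → ℕ →. ℕ} (hΦ : RecursiveFunctional Φ) (hΨ : RecursiveFunctional Ψ) :
      RecursiveFunctional fun p n => Ψ p n >>= Φ p
  | prec {Φ Ψ : Baire → ℕ →. ℕ} (hΦ : RecursiveFunctional Φ) (hΨ : RecursiveFunctional Ψ) :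
      RecursiveFunctional fun p a =>
        let (a, n) := Nat.unpair a
        n.rec (Φ p a) fun y IH => do
          let i ← IH
          Ψ p (Nat.pair a (Nat.pair y i))
  | rfind {Φ : Baire → ℕ →. ℕ} (hΦ : RecursiveFunctional Φ) :
      RecursiveFunctional fun p a =>
        Nat.rfind fun n => (fun m => m = 0) <$> Φ p (Nat.pair a n)

/-- A partial function `F` on Baire space is computable if one oracle program computes, for every
`p` in the domain of `F`, each entry of the sequence `F p` from the entries of `p`. -/
def BaireComputable (F : Baire →. Baire) : Prop :=
  ∃ Φ : Baire → ℕ →. ℕ, RecursiveFunctional Φ ∧ ∀ p q, q ∈ F p → ∀ n, q n ∈ Φ p n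

/-! ### Represented spaces -/

/-- A representation of `X`: a surjective partial function from Baire space to `X`, given by its
graph; `Names p x` says that `p` is a name of `x`. -/
structure BaireRep (X : Type*) where
  Names : Baire → X → Prop
  unique : ∀ {p x y}, Names p x → Names p y → x = y
  surjective : ∀ x, ∃ p, Names p x

namespace BaireRep

/-- Representation of a product: the name of `(x, y)` has a name of `x` at its even places and a
name of `y` at its odd places. -/
def prod {X Y : Type*} (δ : BaireRep X) (ε : BaireRep Y) :
    BaireRep (X × Y) where
  Names r z := δ.Names (fun i => r (2 * i)) z.1 ∧ ε.Names (fun i => r (2 * i + 1)) z.2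
  unique h h' := Prod.ext (δ.unique h.1 h'.1) (ε.unique h.2 h'.2)
  surjective z := by
    obtain ⟨p, hp⟩ := δ.surjective z.1
    obtain ⟨q, hq⟩ := ε.surjective z.2
    refine ⟨fun k => if k % 2 = 0 then p (k / 2) else q (k / 2), ?_, ?_⟩
    · convert hp using 2 with i
      simp
    · convert hq using 2 with i
      have h1 : (2 * i + 1) % 2 = 1 := by omega
      have h2 : (2 * i + 1) / 2 = i := by omega
      simp [h1, h2]

/-- Representation of the sequences in `X`: a name of `(xᵢ)` is a sequence `⟨p₀, p₁, …⟩`, coded by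
the pairing function, of names `pᵢ` of `xᵢ`. -/
def seq {X : Type*} (δ : BaireRep X) : BaireRep (ℕ → X) where
  Names r s := ∀ i, δ.Names (fun j => r (Nat.pair i j)) (s i)
  unique h h' := funext fun i => δ.unique (h i) (h' i)
  surjective s := by
    choose p hp using fun i => δ.surjective (s i)
    exact ⟨fun k => p k.unpair.1 k.unpair.2, fun i => by simpa using hp i⟩

/-- The Cauchy representation of a metric space with respect to a dense sequence `α`. -/
def cauchy {X : Type*} [MetricSpace X] (α : ℕ → X) (hα : DenseRange α) : BaireRep X where
  Names p x := (∀ i j, i ≤ j → dist (α (p i)) (α (p j)) ≤ (2 : ℝ)⁻¹ ^ i) ∧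
    Filter.Tendsto (fun i => α (p i)) Filter.atTop (nhds x)
  unique h h' := tendsto_nhds_unique h.2 h'.2
  surjective x := by
    have hpos : ∀ i : ℕ, (0 : ℝ) < (2 : ℝ)⁻¹ ^ (i + 1) := fun i => by positivity
    choose p hp using fun i : ℕ => hα.exists_dist_lt x (hpos i)
    refine ⟨p, fun i j hij => ?_, ?_⟩
    · have hj : (2 : ℝ)⁻¹ ^ (j + 1) ≤ (2 : ℝ)⁻¹ ^ (i + 1) :=
        pow_le_pow_of_le_one (by norm_num) (by norm_num) (by omega)
      have h2 : (2 : ℝ)⁻¹ ^ (i + 1) = (2 : ℝ)⁻¹ ^ i / 2 := by rw [pow_succ]; ring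
      have := dist_triangle_left (α (p i)) (α (p j)) x
      linarith [hp i, hp j]
    · rw [tendsto_iff_dist_tendsto_zero]
      have h0 : Filter.Tendsto (fun i : ℕ => (2 : ℝ)⁻¹ ^ (i + 1)) Filter.atTop (nhds 0) :=
        (tendsto_pow_atTop_nhds_zero_of_lt_one (by norm_num) (by norm_num)).comp
          (Filter.tendsto_add_atTop_nat 1)
      refine squeeze_zero (fun _ => dist_nonneg) (fun i => ?_) h0
      rw [dist_comm]
      exact (hp i).le

end BaireRep

/-! ### Basic balls and positive information on closed sets -/

/-- An effective enumeration of the rational numbers. -/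
def ratEnum (k : ℕ) : ℚ :=
  (Equiv.intEquivNat.symm k.unpair.1 : ℚ) / ((k.unpair.2 : ℚ) + 1)

/-- An effective enumeration of the nonnegative rational numbers. -/
def nonnegRatEnum (m : ℕ) : ℚ :=
  (m.unpair.1 : ℚ) / ((m.unpair.2 : ℚ) + 1)

theorem ratEnum_surjective : Function.Surjective ratEnum := by
  intro q
  refine ⟨Nat.pair (Equiv.intEquivNat q.num) (q.den - 1), ?_⟩
  have h : ((q.den - 1 : ℕ) : ℚ) + 1 = q.den := by
    exact_mod_cast Nat.sub_add_cancel q.den_pos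
  simp only [ratEnum, Nat.unpair_pair, Equiv.symm_apply_apply, h]
  exact Rat.num_div_den q

theorem exists_nonnegRatEnum_between {r : ℝ} (hr : 0 < r) :
    ∃ m, 0 < (nonnegRatEnum m : ℝ) ∧ (nonnegRatEnum m : ℝ) < r := by
  obtain ⟨k, hk⟩ := exists_nat_one_div_lt hr
  refine ⟨Nat.pair 1 k, ?_, ?_⟩
  · simp only [nonnegRatEnum, Nat.unpair_pair]
    push_cast
    positivity
  · simpa [nonnegRatEnum] using hk

/-- The `k`-th basic open ball, `k = ⟨n, m⟩`: centre `α n`, radius the `m`-th nonnegative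
rational. -/
def basicBall {X : Type*} [MetricSpace X] (α : ℕ → X) (k : ℕ) : Set X :=
  Metric.ball (α k.unpair.1) (nonnegRatEnum k.unpair.2)

/-- The positive information representation of the closed subsets of `X`: `p` is a name of `A` if
it lists exactly the indices of the basic open balls that meet `A`. An entry `k + 1` lists the
index `k`, and an entry `0` lists nothing, so that the empty set has a name too. -/
def BaireRep.positive {X : Type*} [MetricSpace X] (α : ℕ → X) (hα : DenseRange α) :
    BaireRep (Closeds X) where
  Names p A := ∀ k, (∃ i, p i = k + 1) ↔ (basicBall α k ∩ (A : Set X)).Nonempty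
  unique {p A B} hA hB := by
    have key : ∀ A B : Closeds X,
        (∀ k, (basicBall α k ∩ (A : Set X)).Nonempty → (basicBall α k ∩ (B : Set X)).Nonempty) →
        (A : Set X) ⊆ B := by
      intro A B h x hx
      rw [← B.isClosed.closure_eq, Metric.mem_closure_iff]
      intro ε hε
      obtain ⟨m, hm0, hm⟩ := exists_nonnegRatEnum_between (half_pos hε)
      obtain ⟨n, hn⟩ := hα.exists_dist_lt x hm0
      obtain ⟨b, hb, hbB⟩ := h (Nat.pair n m) ⟨x, by simpa [basicBall] using hn, hx⟩
      have hb' : dist b (α n) < nonnegRatEnum m := by simpa [basicBall] using hb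
      refine ⟨b, hbB, ?_⟩
      have := dist_triangle_right x b (α n)
      linarith
    exact SetLike.coe_injective (Set.Subset.antisymm
      (key A B fun k h => (hB k).1 ((hA k).2 h)) (key B A fun k h => (hA k).1 ((hB k).2 h)))
  surjective A := by
    classical
    refine ⟨fun i => if (basicBall α i ∩ (A : Set X)).Nonempty then i + 1 else 0, fun k => ?_⟩
    constructor
    · rintro ⟨i, hi⟩
      dsimp only at hi
      split_ifs at hi with h
      · obtain rfl : i = k := by omega
        exact h
    · intro h
      exact ⟨k, if_pos h⟩

/-! ### The Euclidean spaces -/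

/-- An effective enumeration of `ℚⁿ` in `ℝⁿ`: `k` codes a list of natural numbers, whose `i`-th
entry (`0` if there is none) is the index, in `ratEnum`, of the `i`-th coordinate. -/
def ratVecEnum (n k : ℕ) : EuclideanSpace ℝ (Fin n) :=
  WithLp.toLp 2 fun i => (ratEnum ((Denumerable.ofNat (List ℕ) k).getD i 0) : ℝ)

theorem denseRange_ratEnum : DenseRange fun k => (ratEnum k : ℝ) :=
  Rat.denseRange_cast.comp ratEnum_surjective.denseRange Rat.continuous_coe_real

theorem denseRange_ratVecEnum (n : ℕ) : DenseRange (ratVecEnum n) := by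
  have h1 : DenseRange fun v : Fin n → ℚ => fun i => (v i : ℝ) :=
    DenseRange.piMap fun _ => Rat.denseRange_cast
  have h2 : DenseRange fun v : Fin n → ℚ =>
      (WithLp.toLp 2 fun i => (v i : ℝ) : EuclideanSpace ℝ (Fin n)) :=
    (WithLp.toLp_surjective 2).denseRange.comp h1 (PiLp.continuous_toLp 2 _)
  refine h2.mono ?_
  rintro _ ⟨v, rfl⟩
  choose c hc using fun i => ratEnum_surjective (v i)
  refine ⟨Encodable.encode (List.ofFn c), ?_⟩
  simp [ratVecEnum, hc]

/-- The Cauchy representation of `ℝ`. -/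
def realRep : BaireRep ℝ :=
  BaireRep.cauchy (fun k => (ratEnum k : ℝ)) denseRange_ratEnum

/-- The Cauchy representation of `ℝⁿ` with the Euclidean metric. -/
def euclideanRep (n : ℕ) : BaireRep (EuclideanSpace ℝ (Fin n)) :=
  BaireRep.cauchy (ratVecEnum n) (denseRange_ratVecEnum n)

/-- The closed subsets of `ℝⁿ` with positive information. -/
def euclideanPosRep (n : ℕ) : BaireRep (Closeds (EuclideanSpace ℝ (Fin n))) :=
  BaireRep.positive (ratVecEnum n) (denseRange_ratVecEnum n)

/-! ### Multi-valued functions and strong Weihrauch reducibility -/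

/-- A partial multi-valued function between represented spaces. Its domain consists of the `x`
with `values x` nonempty. -/
structure MultiFunction (X Y : Type*) where
  source : BaireRep X
  target : BaireRep Y
  values : X → Set Y

namespace MultiFunction

/-- The domain of a partial multi-valued function. -/
def dom {X Y : Type*} (f : MultiFunction X Y) : Set X :=
  {x | (f.values x).Nonempty}

/-- `F` realizes `f`: it maps every name of every `x` in the domain of `f` to a name of some
element of `f x`. -/
def Realizes {X Y : Type*} (F : Baire →. Baire) (f : MultiFunction X Y) : Prop :=
  ∀ p x, f.source.Names p x → x ∈ f.dom →
    ∃ q ∈ F p, ∃ y ∈ f.values x, f.target.Names q y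

/-- Strong Weihrauch reducibility: there are computable `H` and `K` such that `K ∘ G ∘ H` realizes
`f` for every realizer `G` of `g`. -/
def StrongReducible {X Y Z W : Type*} (f : MultiFunction X Y) (g : MultiFunction Z W) : Prop :=
  ∃ H K : Baire →. Baire, BaireComputable H ∧ BaireComputable K ∧
    ∀ G : Baire →. Baire, Realizes G g → Realizes (K.comp (G.comp H)) f

/-- Strong Weihrauch equivalence. -/
def StrongEquiv {X Y Z W : Type*} (f : MultiFunction X Y) (g : MultiFunction Z W) : Prop :=
  StrongReducible f g ∧ StrongReducible g f

end MultiFunction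

/-- The exact positive projection operator on `ℝⁿ`: it maps a point `x` and a nonempty closed set
`A`, given by positive information, to the points of `A` at minimal distance from `x`. -/
def projPos (n : ℕ) :
    MultiFunction (EuclideanSpace ℝ (Fin n) × Closeds (EuclideanSpace ℝ (Fin n)))
      (EuclideanSpace ℝ (Fin n)) where
  source := (euclideanRep n).prod (euclideanPosRep n)
  target := euclideanRep n
  values z := {y | y ∈ z.2 ∧ dist z.1 y = Metric.infDist z.1 (z.2 : Set _)}

/-- The Bolzano-Weierstraß operator on `ℝ`: it maps a sequence whose range is relatively compact,
that is, a bounded sequence, to its cluster points. -/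
def bwtReal : MultiFunction (ℕ → ℝ) ℝ where
  source := realRep.seq
  target := realRep
  values a := {y | IsCompact (closure (Set.range a)) ∧ MapClusterPt y Filter.atTop a}

end

/-! Positive information on `A` yields rational points that approach `A` and whose distances to `x`
approach the minimum. Every cluster point of them is a nearest point, so only the choice of a
cluster point is missing, and Bolzano-Weierstraß makes it. Conversely, a sequence of points that
spirals towards a circle has its cluster points as the nearest points of its closure to the centre,
so in dimension at least two a projection chooses a cluster point.

For `projPos_strongReducible_bwtReal`, minimising `ballWeight` over the balls listed so far produces
the required centres (`tendsto_of_ballWeight_le`). They live in `ℝⁿ`, while the oracle answers in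
`ℝ` and the postprocessing sees nothing but the answer. So each centre is turned into a sequence of
numbers by `approx`, which lists least indices of nearby rational vectors and is pointwise bounded
by compactness. Finite initial segments of these sequences are coded in `[0, 1]` with gaps
(`ListCode.separation`). A cluster point of the codes therefore determines a sequence entry by entry
(`ListCode.exists_cluster_of_mapClusterPt`), and this sequence is itself a name of a cluster point
of the centres (`PosProjection.exists_mapClusterPt_names`).

For `bwtReal_strongReducible_projPos`, take a rational `t` within `2⁻¹ ^ s` of the `s`-th term and
place a point at radius `1 + 2⁻¹ ^ s` in the direction of the circle point with parameter `t`. The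
nearest points to the origin have norm one, hence are limits of the spiral. Boundedness keeps the
parameters in a compact set, so these limits are circle points whose parameters are cluster points
of the given sequence (`CircleCode.exists_circlePoint_eq`). The parameter of `(X, Y)` is `Y / (1 +
X)`, found by search (`CircleCode.exists_mem_decoder`). -/

/-! ### Recursive functionals -/

namespace RecursiveFunctional

theorem of_eq {Φ Ψ : Baire → ℕ →. ℕ} (h : RecursiveFunctional Φ) (e : ∀ p n, Φ p n = Ψ p n) :
    RecursiveFunctional Ψ :=
  (funext fun p => funext (e p) : Φ = Ψ) ▸ h

theorem of_partrec {f : ℕ →. ℕ} (hf : Nat.Partrec f) : RecursiveFunctional fun _ => f := by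
  induction hf with
  | zero => exact zero
  | succ => exact succ
  | left => exact left
  | right => exact right
  | pair _ _ hf hg => exact pair hf hg
  | comp _ _ hf hg => exact comp hf hg
  | prec _ _ hf hg => exact prec hf hg
  | rfind _ hf => exact rfind hf

theorem of_computable {f : ℕ → ℕ} (hf : Computable f) :
    RecursiveFunctional fun _ n => Part.some (f n) :=
  of_partrec (Partrec.nat_iff.1 hf)

/-- A functional that makes one query to the oracle. -/
theorem query {b : ℕ → ℕ} (hb : Computable b) {f : ℕ → ℕ → ℕ} (hf : Computable₂ f) :
    RecursiveFunctional fun p n => Part.some (f n (p (b n))) := by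
  have hf' : Computable fun v : ℕ => f v.unpair.1 v.unpair.2 :=
    hf.comp (Computable.fst.comp .unpair) (Computable.snd.comp .unpair)
  refine (comp (of_computable hf')
    (pair (of_computable Computable.id) (comp oracle (of_computable hb)))).of_eq fun p n => ?_
  simp [Seq.seq]

/-- The code of the finite initial segments of the oracle. -/
theorem initialSegment :
    RecursiveFunctional fun p n => Part.some (Encodable.encode ((List.range n).map p)) := by
  -- The recursion step receives `⟨a, ⟨y, i⟩⟩`, where `y` entries have been read and `i` codes their
  -- list; the one query is made at `y`.
  have hg : Computable₂ fun v a : ℕ =>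
      Encodable.encode (Denumerable.ofNat (List ℕ) v.unpair.2.unpair.2 ++ [a]) := by
    refine Computable.encode.comp (Computable.list_concat.comp ((Computable.ofNat (List ℕ)).comp ?_)
      Computable.snd)
    exact Computable.snd.comp (Computable.unpair.comp
      (Computable.snd.comp (Computable.unpair.comp Computable.fst)))
  have hb : Computable fun v : ℕ => v.unpair.2.unpair.1 :=
    Computable.fst.comp (Computable.unpair.comp (Computable.snd.comp Computable.unpair))
  refine (comp (prec (of_computable (Computable.const (Encodable.encode ([] : List ℕ))))
    (query hb hg)) (pair zero (of_computable Computable.id))).of_eq fun p n => ?_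
  simp only [Seq.seq, Part.map_eq_map, Part.map_some, Part.bind_some, id, Part.bind_eq_bind,
    Nat.unpair_pair]
  induction n with
  | zero => simp
  | succ n ih =>
    dsimp only
    rw [ih]
    simp [List.range_succ]

/-- A functional that inspects an initial segment of the oracle of computable length. -/
theorem of_initialSegment {b : ℕ → ℕ} (hb : Computable b) {f : List ℕ → ℕ → ℕ}
    (hf : Computable₂ f) :
    RecursiveFunctional fun p n => Part.some (f ((List.range (b n)).map p) n) := by
  have hf' : Computable fun v : ℕ => f (Denumerable.ofNat (List ℕ) v.unpair.1) v.unpair.2 :=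
    hf.comp ((Computable.ofNat _).comp (Computable.fst.comp .unpair))
      (Computable.snd.comp .unpair)
  refine (comp (of_computable hf') (pair (comp initialSegment (of_computable hb))
    (of_computable Computable.id))).of_eq fun p n => ?_
  simp [Seq.seq]

/-- Unbounded search for a witness, each candidate being tested with one query to the oracle. -/
theorem search {b : ℕ → ℕ} (hb : Computable b) {T : ℕ → ℕ → ℕ → Bool}
    (hT : Computable fun v : ℕ × ℕ × ℕ => T v.1 v.2.1 v.2.2) {g : ℕ → ℕ → ℕ}
    (hg : Computable₂ g) :
    RecursiveFunctional fun p n =>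
      (Nat.rfind fun w => Part.some (T n w (p (b w)))).map (g n) := by
  have hg' : Computable fun v : ℕ => g v.unpair.1 v.unpair.2 :=
    hg.comp (Computable.fst.comp .unpair) (Computable.snd.comp .unpair)
  -- The operator `rfind` looks for the value zero, so success is coded by `0`.
  have hT' : Computable₂ fun v a : ℕ => cond (T v.unpair.1 v.unpair.2 a) 0 1 := by
    have h1 : Computable fun v : ℕ × ℕ => v.1.unpair.1 :=
      Computable.fst.comp (Computable.unpair.comp Computable.fst)
    have h2 : Computable fun v : ℕ × ℕ => v.1.unpair.2 :=
      Computable.snd.comp (Computable.unpair.comp Computable.fst)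
    have h3 : Computable fun v : ℕ × ℕ => T v.1.unpair.1 v.1.unpair.2 v.2 :=
      Computable.comp (f := fun v : ℕ × ℕ × ℕ => T v.1 v.2.1 v.2.2)
        (g := fun v : ℕ × ℕ => (v.1.unpair.1, v.1.unpair.2, v.2)) hT
        (h1.pair (h2.pair Computable.snd))
    exact Computable.cond h3 (Computable.const 0) (Computable.const 1)
  have hb' : Computable fun v : ℕ => b v.unpair.2 :=
    hb.comp (Computable.snd.comp .unpair)
  refine (comp (of_computable hg')
    (pair (of_computable Computable.id) (rfind (query hb' hT')))).of_eq fun p n => ?_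
  have : (fun w => (fun m => (decide (m = 0) : Bool)) <$> Part.some
      (cond (T (Nat.pair n w).unpair.1 (Nat.pair n w).unpair.2 (p (b (Nat.pair n w).unpair.2)))
        0 1)) = fun w => Part.some (T n w (p (b w))) := by
    funext w
    cases h : T n w (p (b w)) <;> simp [h]
  rw [this]
  simp only [Seq.seq, Part.map_eq_map, Part.map_some, Part.bind_some, id, Part.bind_eq_bind,
    Part.bind_some_eq_map, Part.map_map]
  congr 1
  funext w
  simp

end RecursiveFunctional

/-- The partial function on Baire space computed by a functional. -/
def functionalToBaire (Φ : Baire → ℕ →. ℕ) : Baire →. Baire :=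
  fun p => ⟨∀ n, (Φ p n).Dom, fun h n => (Φ p n).get (h n)⟩

theorem mem_functionalToBaire {Φ : Baire → ℕ →. ℕ} {p q : Baire} :
    q ∈ functionalToBaire Φ p ↔ ∀ n, q n ∈ Φ p n := by
  constructor
  · rintro ⟨h, rfl⟩ n
    exact ⟨h n, rfl⟩
  · intro h
    exact ⟨fun n => (h n).1, funext fun n => (h n).2⟩

theorem RecursiveFunctional.baireComputable {Φ : Baire → ℕ →. ℕ} (h : RecursiveFunctional Φ) :
    BaireComputable (functionalToBaire Φ) :=
  ⟨Φ, h, fun _ _ hq => mem_functionalToBaire.1 hq⟩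

/-- Strong reducibility through a total preprocessing `h` and a functional `Ψ` for
postprocessing. -/
theorem MultiFunction.StrongReducible.of_functional {X Y Z W : Type*} {f : MultiFunction X Y}
    {g : MultiFunction Z W} {h : Baire → Baire} {Ψ : Baire → ℕ →. ℕ}
    (hh : RecursiveFunctional fun p n => Part.some (h p n)) (hΨ : RecursiveFunctional Ψ)
    (H : ∀ p x, f.source.Names p x → x ∈ f.dom →
      ∃ z ∈ g.dom, g.source.Names (h p) z ∧
        ∀ w ∈ g.values z, ∀ r, g.target.Names r w →
          ∃ q y, (∀ n, q n ∈ Ψ r n) ∧ y ∈ f.values x ∧ f.target.Names q y) :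
    StrongReducible f g := by
  refine ⟨_, _, hh.baireComputable, hΨ.baireComputable, fun G hG p x hp hx => ?_⟩
  obtain ⟨z, hz, hpz, hw⟩ := H p x hp hx
  obtain ⟨r, hr, w, hwz, hrw⟩ := hG _ _ hpz hz
  obtain ⟨q, y, hq, hy, hqy⟩ := hw w hwz r hrw
  refine ⟨q, ?_, y, hy, hqy⟩
  refine Part.mem_bind_iff.2 ⟨r, Part.mem_bind_iff.2 ⟨h p, ?_, hr⟩, mem_functionalToBaire.2 hq⟩
  exact mem_functionalToBaire.2 fun n => Part.mem_some _

/-! ### Arithmetic on the indices of rational numbers -/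

namespace RatIndex

/-- The positive part of the integer with code `c`. -/
def intPos (c : ℕ) : ℕ := if c % 2 = 0 then c / 2 else 0

/-- The negative part of the integer with code `c`. -/
def intNeg (c : ℕ) : ℕ := if c % 2 = 0 then 0 else c / 2 + 1

/-- The code of the integer `a - b`. -/
def intDiff (a b : ℕ) : ℕ := if b ≤ a then 2 * (a - b) else 2 * (b - a - 1) + 1

theorem intEquivNat_symm_two_mul (a : ℕ) : Equiv.intEquivNat.symm (2 * a) = (a : ℤ) := by
  rw [Equiv.symm_apply_eq]
  rfl

theorem intEquivNat_symm_two_mul_add_one (a : ℕ) :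
    Equiv.intEquivNat.symm (2 * a + 1) = -((a : ℤ) + 1) := by
  rw [Equiv.symm_apply_eq, ← Int.negSucc_eq]
  simp [Equiv.intEquivNat, Equiv.intEquivNatSumNat]

theorem intEquivNat_symm_eq (c : ℕ) :
    Equiv.intEquivNat.symm c = (intPos c : ℤ) - intNeg c := by
  obtain ⟨a, rfl | rfl⟩ := Nat.even_or_odd' c
  · rw [intEquivNat_symm_two_mul]
    simp [intPos, intNeg]
  · rw [intEquivNat_symm_two_mul_add_one]
    have h1 : (2 * a + 1) % 2 = 1 := by omega
    have h2 : (2 * a + 1) / 2 = a := by omega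
    simp [intPos, intNeg, h1, h2]

theorem intEquivNat_symm_intDiff (a b : ℕ) :
    Equiv.intEquivNat.symm (intDiff a b) = (a : ℤ) - b := by
  unfold intDiff
  split_ifs with h
  · rw [intEquivNat_symm_two_mul]
    omega
  · rw [intEquivNat_symm_two_mul_add_one]
    omega

theorem primrec_intPos : Primrec intPos :=
  Primrec.ite (Primrec.eq.comp (Primrec.nat_mod.comp .id (.const 2)) (.const 0))
    (Primrec.nat_div.comp .id (.const 2)) (.const 0)

theorem primrec_intNeg : Primrec intNeg :=
  Primrec.ite (Primrec.eq.comp (Primrec.nat_mod.comp .id (.const 2)) (.const 0))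
    (.const 0) (Primrec.succ.comp (Primrec.nat_div.comp .id (.const 2)))

theorem primrec_intDiff : Primrec₂ intDiff :=
  Primrec.ite (Primrec.nat_le.comp .snd .fst)
    (Primrec.nat_double.comp (Primrec.nat_sub.comp .fst .snd))
    (Primrec.nat_double_succ.comp
      (Primrec.nat_sub.comp (Primrec.nat_sub.comp .snd .fst) (.const 1)))

/-- The positive part of the numerator. -/
def numPos (k : ℕ) : ℕ := intPos k.unpair.1

/-- The negative part of the numerator. -/
def numNeg (k : ℕ) : ℕ := intNeg k.unpair.1

/-- The denominator. -/
def denom (k : ℕ) : ℕ := k.unpair.2 + 1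

/-- An index of `(a - b) / d`. -/
def mk (a b d : ℕ) : ℕ := Nat.pair (intDiff a b) (d - 1)

theorem denom_pos (k : ℕ) : 0 < (denom k : ℚ) := by
  unfold denom
  positivity

theorem ratEnum_eq (k : ℕ) : ratEnum k = ((numPos k : ℚ) - numNeg k) / denom k := by
  unfold ratEnum numPos numNeg denom
  rw [intEquivNat_symm_eq]
  push_cast
  rfl

theorem ratEnum_mk (a b : ℕ) {d : ℕ} (hd : 0 < d) : ratEnum (mk a b d) = ((a : ℚ) - b) / d := by
  obtain ⟨d, rfl⟩ := Nat.exists_eq_add_of_lt hd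
  simp only [ratEnum, mk, Nat.unpair_pair, intEquivNat_symm_intDiff]
  push_cast
  simp

theorem primrec_numPos : Primrec numPos := primrec_intPos.comp (Primrec.fst.comp .unpair)

theorem primrec_numNeg : Primrec numNeg := primrec_intNeg.comp (Primrec.fst.comp .unpair)

theorem primrec_denom : Primrec denom := Primrec.succ.comp (Primrec.snd.comp .unpair)

theorem primrec_mk {α : Type*} [Primcodable α] {a b d : α → ℕ} (ha : Primrec a) (hb : Primrec b)
    (hd : Primrec d) : Primrec fun v => mk (a v) (b v) (d v) :=
  Primrec₂.natPair.comp (primrec_intDiff.comp ha hb) (Primrec.nat_sub.comp hd (.const 1))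

/-- An index of the sum. -/
def add (j k : ℕ) : ℕ :=
  mk (numPos j * denom k + numPos k * denom j) (numNeg j * denom k + numNeg k * denom j)
    (denom j * denom k)

/-- An index of the product. -/
def mul (j k : ℕ) : ℕ :=
  mk (numPos j * numPos k + numNeg j * numNeg k) (numPos j * numNeg k + numNeg j * numPos k)
    (denom j * denom k)

/-- An index of the negative. -/
def neg (k : ℕ) : ℕ := mk (numNeg k) (numPos k) (denom k)

/-- An index of the inverse of a positive number. -/
def inv (k : ℕ) : ℕ := mk (denom k) 0 (numPos k - numNeg k)

/-- An index of the difference. -/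
def sub (j k : ℕ) : ℕ := add j (neg k)

/-- An index of the square. -/
def sq (k : ℕ) : ℕ := mul k k

/-- An index of `2⁻¹ ^ i`. -/
def twoInvPow (i : ℕ) : ℕ := mk 1 0 (2 ^ i)

/-- The order of the rational numbers on indices. -/
def lt (j k : ℕ) : Bool :=
  numPos j * denom k + numNeg k * denom j < numPos k * denom j + numNeg j * denom k

theorem ratEnum_add (j k : ℕ) : ratEnum (add j k) = ratEnum j + ratEnum k := by
  have hj := denom_pos j
  have hk := denom_pos k
  rw [add, ratEnum_mk _ _ (by simp [denom]), ratEnum_eq j, ratEnum_eq k]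
  push_cast
  field_simp
  ring

theorem ratEnum_mul (j k : ℕ) : ratEnum (mul j k) = ratEnum j * ratEnum k := by
  have hj := denom_pos j
  have hk := denom_pos k
  rw [mul, ratEnum_mk _ _ (by simp [denom]), ratEnum_eq j, ratEnum_eq k]
  push_cast
  field_simp
  ring

theorem ratEnum_neg (k : ℕ) : ratEnum (neg k) = -ratEnum k := by
  rw [neg, ratEnum_mk _ _ (by simp [denom]), ratEnum_eq k]
  ring

theorem ratEnum_sub (j k : ℕ) : ratEnum (sub j k) = ratEnum j - ratEnum k := by
  rw [sub, ratEnum_add, ratEnum_neg, sub_eq_add_neg]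

theorem ratEnum_sq (k : ℕ) : ratEnum (sq k) = ratEnum k ^ 2 := by
  rw [sq, ratEnum_mul, pow_two]

theorem ratEnum_inv {k : ℕ} (hk : 0 < ratEnum k) : ratEnum (inv k) = (ratEnum k)⁻¹ := by
  have hd := denom_pos k
  rw [ratEnum_eq] at hk
  -- Positivity makes the truncated subtraction in `inv` exact.
  have h : (numNeg k : ℚ) < numPos k := by
    by_contra h
    exact absurd hk (not_lt.2 (div_nonpos_of_nonpos_of_nonneg (by linarith) hd.le))
  have h' : numNeg k < numPos k := by exact_mod_cast h
  rw [inv, ratEnum_mk _ _ (by omega), Nat.cast_sub h'.le, ratEnum_eq]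
  simp

theorem ratEnum_twoInvPow (i : ℕ) : ratEnum (twoInvPow i) = 2⁻¹ ^ i := by
  rw [twoInvPow, ratEnum_mk _ _ (by positivity)]
  simp

theorem lt_iff (j k : ℕ) : lt j k ↔ ratEnum j < ratEnum k := by
  have hj := denom_pos j
  have hk := denom_pos k
  rw [ratEnum_eq, ratEnum_eq, div_lt_div_iff₀ hj hk, lt, decide_eq_true_iff, ← Nat.cast_lt (α := ℚ)]
  push_cast
  constructor <;> intro h <;> linarith

theorem primrec_add : Primrec₂ add :=
  have n1 : Primrec fun v : ℕ × ℕ => numPos v.1 := primrec_numPos.comp .fst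
  have n2 : Primrec fun v : ℕ × ℕ => numPos v.2 := primrec_numPos.comp .snd
  have m1 : Primrec fun v : ℕ × ℕ => numNeg v.1 := primrec_numNeg.comp .fst
  have m2 : Primrec fun v : ℕ × ℕ => numNeg v.2 := primrec_numNeg.comp .snd
  have d1 : Primrec fun v : ℕ × ℕ => denom v.1 := primrec_denom.comp .fst
  have d2 : Primrec fun v : ℕ × ℕ => denom v.2 := primrec_denom.comp .snd
  primrec_mk (Primrec.nat_add.comp (Primrec.nat_mul.comp n1 d2) (Primrec.nat_mul.comp n2 d1))
    (Primrec.nat_add.comp (Primrec.nat_mul.comp m1 d2) (Primrec.nat_mul.comp m2 d1))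
    (Primrec.nat_mul.comp d1 d2)

theorem primrec_mul : Primrec₂ mul :=
  have n1 : Primrec fun v : ℕ × ℕ => numPos v.1 := primrec_numPos.comp .fst
  have n2 : Primrec fun v : ℕ × ℕ => numPos v.2 := primrec_numPos.comp .snd
  have m1 : Primrec fun v : ℕ × ℕ => numNeg v.1 := primrec_numNeg.comp .fst
  have m2 : Primrec fun v : ℕ × ℕ => numNeg v.2 := primrec_numNeg.comp .snd
  have d1 : Primrec fun v : ℕ × ℕ => denom v.1 := primrec_denom.comp .fst
  have d2 : Primrec fun v : ℕ × ℕ => denom v.2 := primrec_denom.comp .snd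
  primrec_mk (Primrec.nat_add.comp (Primrec.nat_mul.comp n1 n2) (Primrec.nat_mul.comp m1 m2))
    (Primrec.nat_add.comp (Primrec.nat_mul.comp n1 m2) (Primrec.nat_mul.comp m1 n2))
    (Primrec.nat_mul.comp d1 d2)

theorem primrec_neg : Primrec neg := primrec_mk primrec_numNeg primrec_numPos primrec_denom

theorem primrec_inv : Primrec inv :=
  primrec_mk primrec_denom (.const 0) (Primrec.nat_sub.comp primrec_numPos primrec_numNeg)

theorem primrec_sub : Primrec₂ sub := primrec_add.comp .fst (primrec_neg.comp .snd)

theorem primrec_sq : Primrec sq := primrec_mul.comp .id .id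

theorem primrec_nat_pow : Primrec₂ ((· ^ ·) : ℕ → ℕ → ℕ) := Primrec₂.unpaired'.1 Nat.Primrec.pow

theorem primrec_twoInvPow : Primrec twoInvPow :=
  primrec_mk (.const 1) (.const 0) (primrec_nat_pow.comp (.const 2) .id)

theorem primrec_lt : Primrec₂ lt :=
  have n1 : Primrec fun v : ℕ × ℕ => numPos v.1 := primrec_numPos.comp .fst
  have n2 : Primrec fun v : ℕ × ℕ => numPos v.2 := primrec_numPos.comp .snd
  have m1 : Primrec fun v : ℕ × ℕ => numNeg v.1 := primrec_numNeg.comp .fst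
  have m2 : Primrec fun v : ℕ × ℕ => numNeg v.2 := primrec_numNeg.comp .snd
  have d1 : Primrec fun v : ℕ × ℕ => denom v.1 := primrec_denom.comp .fst
  have d2 : Primrec fun v : ℕ × ℕ => denom v.2 := primrec_denom.comp .snd
  PrimrecPred.decide (Primrec.nat_lt.comp
    (Primrec.nat_add.comp (Primrec.nat_mul.comp n1 d2) (Primrec.nat_mul.comp m2 d1))
    (Primrec.nat_add.comp (Primrec.nat_mul.comp n2 d1) (Primrec.nat_mul.comp m1 d2)))

attribute [irreducible] mk add mul neg inv sub sq twoInvPow lt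

/-- An index, in `ratEnum`, of the `m`-th nonnegative rational. -/
def ofNonneg (m : ℕ) : ℕ := mk m.unpair.1 0 (m.unpair.2 + 1)

theorem ratEnum_ofNonneg (m : ℕ) : ratEnum (ofNonneg m) = nonnegRatEnum m := by
  rw [ofNonneg, ratEnum_mk _ _ (by omega), nonnegRatEnum]
  push_cast
  simp

theorem primrec_ofNonneg : Primrec ofNonneg :=
  primrec_mk (Primrec.fst.comp .unpair) (.const 0) (Primrec.succ.comp (Primrec.snd.comp .unpair))

/-- The index of the `i`-th coordinate of the `k`-th rational vector. -/
def coord (i k : ℕ) : ℕ := (Denumerable.ofNat (List ℕ) k).getD i 0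

theorem primrec_coord (i : ℕ) : Primrec (coord i) :=
  (Primrec.list_getD 0).comp (Primrec.ofNat (List ℕ)) (.const i)

theorem ratVecEnum_apply {n : ℕ} (k : ℕ) (i : Fin n) :
    ratVecEnum n k i = (ratEnum (coord i k) : ℝ) := rfl

/-- An index of the squared distance of two rational vectors of dimension `n`. -/
def distSq : ℕ → ℕ → ℕ → ℕ
  | 0, _, _ => 0
  | n + 1, j, k => add (distSq n j k) (sq (sub (coord n j) (coord n k)))

/-- Thus the default entry `0` in `coord` pads short lists with zero coordinates. -/
theorem ratEnum_zero : ratEnum 0 = 0 := by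
  have := intEquivNat_symm_two_mul 0
  simp only [mul_zero, Nat.cast_zero] at this
  simp [ratEnum, this]

theorem ratEnum_distSq_eq_sum (n j k : ℕ) :
    ratEnum (distSq n j k) =
      ∑ i : Fin n, (ratEnum (coord i j) - ratEnum (coord i k)) ^ 2 := by
  induction n with
  | zero => simp [distSq, ratEnum_zero]
  | succ n ih => rw [Fin.sum_univ_castSucc, distSq, ratEnum_add, ratEnum_sq, ratEnum_sub, ih]; simp

/-- Squares of distances between rational vectors are rational, so distances can be compared on
indices after squaring. -/
theorem ratEnum_distSq (n j k : ℕ) :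
    (ratEnum (distSq n j k) : ℝ) = dist (ratVecEnum n j) (ratVecEnum n k) ^ 2 := by
  rw [EuclideanSpace.dist_sq_eq, ratEnum_distSq_eq_sum]
  push_cast
  refine Finset.sum_congr rfl fun i _ => ?_
  rw [ratVecEnum_apply, ratVecEnum_apply, Real.dist_eq, sq_abs]

theorem primrec_distSq (n : ℕ) : Primrec₂ (distSq n) := by
  induction n with
  | zero => exact Primrec₂.const 0
  | succ n ih =>
    exact primrec_add.comp ih (primrec_sq.comp (primrec_sub.comp
      ((primrec_coord n).comp .fst) ((primrec_coord n).comp .snd)))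

end RatIndex

/-! ### Cluster points in Baire space from cluster points of real sequences -/

open Filter Topology

theorem BaireRep.cauchy_dist_le {X : Type*} [MetricSpace X] {α : ℕ → X} {hα : DenseRange α}
    {p : Baire} {x : X} (h : (BaireRep.cauchy α hα).Names p x) (i : ℕ) :
    dist (α (p i)) x ≤ (2 : ℝ)⁻¹ ^ i :=
  le_of_tendsto (tendsto_const_nhds.dist h.2)
    ((eventually_ge_atTop i).mono fun j hj => h.1 i j hj)

/-! ### Coding finite sequences of numbers by separated reals. -/

namespace ListCode

/-- An injective code of finite sequences of numbers by real numbers in `[0, 1]`. -/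
noncomputable def code : List ℕ → ℝ
  | [] => 0
  | a :: l => (4 + code l) * 8⁻¹ ^ (a + 1)

/-- The diameter of the interval occupied by the codes of the extensions of a finite sequence. -/
noncomputable def width : List ℕ → ℝ
  | [] => 1
  | a :: l => width l * 8⁻¹ ^ (a + 1)

theorem eight_inv_pow_succ_le (a : ℕ) : (8⁻¹ : ℝ) ^ (a + 1) ≤ 8⁻¹ := by
  have := pow_le_one₀ (n := a) (by norm_num : (0 : ℝ) ≤ 8⁻¹) (by norm_num)
  rw [pow_succ]
  linarith

theorem code_nonneg : ∀ l, 0 ≤ code l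
  | [] => le_rfl
  | a :: l => by
    have := code_nonneg l
    unfold code
    positivity

theorem code_le_one : ∀ l, code l ≤ 1
  | [] => zero_le_one
  | a :: l => by
    have h1 := code_le_one l
    have h2 := eight_inv_pow_succ_le a
    have h3 : (0 : ℝ) < 8⁻¹ ^ (a + 1) := by positivity
    unfold code
    nlinarith

theorem width_pos : ∀ l, 0 < width l
  | [] => zero_lt_one
  | a :: l => by
    have := width_pos l
    unfold width
    positivity

theorem width_le_one : ∀ l, width l ≤ 1
  | [] => le_rfl
  | a :: l => by
    have h1 := width_le_one l
    have h2 := eight_inv_pow_succ_le a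
    have h3 : (0 : ℝ) < 8⁻¹ ^ (a + 1) := by positivity
    unfold width
    nlinarith

theorem code_append (l l' : List ℕ) : code (l ++ l') = code l + width l * code l' := by
  induction l with
  | nil => simp [code, width]
  | cons a l ih =>
    rw [List.cons_append, code, code, width, ih]
    ring

theorem abs_code_append_sub_le (l l' : List ℕ) : |code (l ++ l') - code l| ≤ width l := by
  have h0 := code_nonneg l'
  have h1 := code_le_one l'
  have h2 := width_pos l
  rw [code_append, add_sub_cancel_left, abs_of_nonneg (by positivity)]
  nlinarith

/-- Let `u = 8⁻¹ ^ (a + 1)`. The left code is at least `4u`, the right one at most `5u/8`, and the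
widths add up to at most `9u/8`, twice which is below the gap. -/
theorem separation_of_head_lt {a b : ℕ} (h : a < b) (l l' : List ℕ) :
    2 * (width (a :: l) + width (b :: l')) ≤ code (a :: l) - code (b :: l') := by
  obtain ⟨c, rfl⟩ := Nat.exists_eq_add_of_lt h
  have hu : (0 : ℝ) < 8⁻¹ ^ (a + 1) := by positivity
  have hv : (8⁻¹ : ℝ) ^ (a + c + 1 + 1) ≤ 8⁻¹ ^ (a + 1) * 8⁻¹ := by
    rw [show a + c + 1 + 1 = (a + 1) + (c + 1) by ring, pow_add]
    exact mul_le_mul_of_nonneg_left (eight_inv_pow_succ_le c) hu.le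
  have hv0 : (0 : ℝ) < 8⁻¹ ^ (a + c + 1 + 1) := by positivity
  have h1 := mul_le_mul_of_nonneg_right (width_le_one l) hu.le
  have h2 := mul_le_mul_of_nonneg_right (width_le_one l') hv0.le
  have h3 := mul_nonneg (code_nonneg l) hu.le
  have h4 := mul_le_mul_of_nonneg_right (code_le_one l') hv0.le
  simp only [code, width]
  linarith

/-- Equal heads cancel and rescale both sides by the same factor, so only the first difference
counts. Equal lengths exclude proper prefixes, whose intervals would be nested. -/
theorem separation {l l' : List ℕ} (hlen : l.length = l'.length) (hne : l ≠ l') :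
    2 * (width l + width l') ≤ |code l - code l'| := by
  induction l generalizing l' with
  | nil => exact absurd (List.eq_nil_of_length_eq_zero hlen.symm).symm hne
  | cons a l ih =>
    cases l' with
    | nil => simp at hlen
    | cons b l' =>
      rcases lt_trichotomy a b with h | rfl | h
      · exact (separation_of_head_lt h l l').trans (le_abs_self _)
      · have hl : l ≠ l' := fun h => hne (h ▸ rfl)
        have h := ih (by simpa using hlen) hl
        have hu : (0 : ℝ) < 8⁻¹ ^ (a + 1) := by positivity
        have := mul_le_mul_of_nonneg_right h hu.le
        simp only [code, width]
        rw [← sub_mul, abs_mul, abs_of_pos hu, add_sub_add_left_eq_sub]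
        linarith
      · rw [abs_sub_comm, add_comm]
        exact (separation_of_head_lt h l' l).trans (le_abs_self _)

/-- A finite sequence is determined by its length and an approximation of its code. -/
theorem eq_of_near {l l' : List ℕ} (hlen : l.length = l'.length) {y : ℝ}
    (h : |y - code l| < 2 * width l) (h' : |y - code l'| < 2 * width l') : l = l' := by
  by_contra hne
  have h1 := separation hlen hne
  have h2 := abs_sub_le (code l) y (code l')
  rw [abs_sub_comm (code l) y] at h2
  linarith

theorem map_range_eq_append (P : ℕ → ℕ) {i s : ℕ} (h : i ≤ s) :
    ∃ l, (List.range s).map P = (List.range i).map P ++ l := by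
  obtain ⟨k, rfl⟩ := Nat.exists_eq_add_of_le h
  rw [List.range_add, List.map_append]
  exact ⟨_, rfl⟩

/-! ### Cluster points of codes. -/

section Cluster

variable {P : ℕ → ℕ → ℕ} {y : ℝ}

/-- The initial segment of `P s` of length `i` is determined by the code of `P s` near `y`. -/
theorem exists_pos_forall_map_range_eq {l : List ℕ} {i : ℕ} (hl : l.length = i)
    (h : |y - code l| < 2 * width l) :
    ∃ ε > 0, ∀ s ≥ i, |code ((List.range s).map (P s)) - y| < ε → (List.range i).map (P s) = l := by
  -- The radius is the slack in `h`. A different initial segment would have its code at least twice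
  -- both widths away from `code l`, and extending it moves the code by at most one of its widths.
  refine ⟨2 * width l - |y - code l|, by linarith, fun s hs hy => ?_⟩
  obtain ⟨t, ht⟩ := map_range_eq_append (P s) hs
  by_contra hne
  have h1 := separation (by simp [hl]) hne
  have h2 := abs_code_append_sub_le ((List.range i).map (P s)) t
  rw [← ht] at h2
  have h3 := abs_sub_le (code ((List.range i).map (P s))) (code ((List.range s).map (P s))) (code l)
  have h4 := abs_sub_le (code ((List.range s).map (P s))) y (code l)
  rw [abs_sub_comm _ (code ((List.range s).map (P s)))] at h3
  have := width_pos ((List.range i).map (P s))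
  linarith

/-- Pointwise boundedness leaves finitely many initial segments of length `i`, so the intervals
about their codes form a closed set. It contains all but finitely many terms of the sequence, hence
also `y`. -/
theorem exists_near_of_mapClusterPt (hP : ∀ i, ∃ B, ∀ s, P s i ≤ B)
    (hy : MapClusterPt y atTop fun s => code ((List.range s).map (P s))) (i : ℕ) :
    ∃ l : List ℕ, l.length = i ∧ |y - code l| < 2 * width l := by
  have hfin : (Set.range fun s => (List.range i).map (P s)).Finite := by
    induction i with
    | zero => exact (Set.finite_singleton []).subset (by rintro _ ⟨s, rfl⟩; simp)
    | succ i ih =>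
      obtain ⟨B, hB⟩ := hP i
      refine (ih.image2 (fun l a => l ++ [a]) (Set.finite_Iic B)).subset ?_
      rintro _ ⟨s, rfl⟩
      exact ⟨_, ⟨s, rfl⟩, P s i, hB s, by simp [List.range_succ]⟩
  set C : Set ℝ := ⋃ l ∈ Set.range fun s => (List.range i).map (P s),
    Metric.closedBall (code l) (width l)
  have hC : IsClosed C := hfin.isClosed_biUnion fun _ _ => Metric.isClosed_closedBall
  have hmem : y ∈ C := by
    refine hC.mem_of_mapClusterPt hy ((eventually_ge_atTop i).mono fun s hs => ?_)
    obtain ⟨t, ht⟩ := map_range_eq_append (P s) hs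
    refine Set.mem_biUnion (Set.mem_range_self s) ?_
    rw [Metric.mem_closedBall, Real.dist_eq, ht]
    exact abs_code_append_sub_le _ _
  obtain ⟨l, ⟨s, rfl⟩, hl⟩ := Set.mem_iUnion₂.1 hmem
  refine ⟨(List.range i).map (P s), by simp, ?_⟩
  rw [Metric.mem_closedBall, Real.dist_eq] at hl
  dsimp only at hl
  have := width_pos ((List.range i).map (P s))
  linarith

/-- A cluster point of the codes of a pointwise bounded sequence in Baire space determines a
sequence `q`, any two entries of which occur infinitely often together. -/
theorem exists_cluster_of_mapClusterPt (hP : ∀ i, ∃ B, ∀ s, P s i ≤ B)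
    (hy : MapClusterPt y atTop fun s => code ((List.range s).map (P s))) :
    ∃ q : ℕ → ℕ, (∀ i, ∃ l : List ℕ, l.length = i + 1 ∧ |y - code l| < 2 * width l) ∧
      (∀ i (l : List ℕ), l.length = i + 1 → |y - code l| < 2 * width l → l.getD i 0 = q i) ∧
      ∀ i j, ∃ᶠ s in atTop, P s i = q i ∧ P s j = q j := by
  choose l hlen hl using fun i => exists_near_of_mapClusterPt hP hy (i + 1)
  refine ⟨fun i => (l i).getD i 0, fun i => ⟨l i, hlen i, hl i⟩, fun i l' h h' => ?_,
    fun i j => ?_⟩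
  · rw [eq_of_near (h.trans (hlen i).symm) h' (hl i)]
  · obtain ⟨ε, hε, hi⟩ := exists_pos_forall_map_range_eq (P := P) (hlen i) (hl i)
    obtain ⟨δ, hδ, hj⟩ := exists_pos_forall_map_range_eq (P := P) (hlen j) (hl j)
    -- The smaller radius lets the same `s` serve both `i` and `j`.
    have hfr := hy.frequently (Metric.ball_mem_nhds y (lt_min hε hδ))
    refine (hfr.and_eventually ((eventually_ge_atTop (i + 1)).and
      (eventually_ge_atTop (j + 1)))).mono ?_
    rintro s ⟨hs, hsi, hsj⟩
    rw [Real.dist_eq, lt_min_iff] at hs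
    dsimp only
    constructor
    · rw [← hi s hsi hs.1]
      simp [List.getD]
    · rw [← hj s hsj hs.2]
      simp [List.getD]

end Cluster

/-! ### Computing the code and inverting it by search. -/

/-- An index of the rational number `code l`. -/
def codeIndex (l : List ℕ) : ℕ :=
  l.foldr (fun a t => RatIndex.mul (RatIndex.add (RatIndex.mk 4 0 1) t)
    (RatIndex.twoInvPow (3 * (a + 1)))) 0

/-- An index of the rational number `width l`. -/
def widthIndex (l : List ℕ) : ℕ :=
  l.foldr (fun a t => RatIndex.mul t (RatIndex.twoInvPow (3 * (a + 1)))) (RatIndex.mk 1 0 1)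

theorem ratEnum_twoInvPow_three_mul (a : ℕ) :
    (ratEnum (RatIndex.twoInvPow (3 * a)) : ℝ) = 8⁻¹ ^ a := by
  rw [RatIndex.ratEnum_twoInvPow, pow_mul]
  push_cast
  norm_num

theorem ratEnum_codeIndex (l : List ℕ) : (ratEnum (codeIndex l) : ℝ) = code l := by
  induction l with
  | nil => simp [codeIndex, code, RatIndex.ratEnum_zero]
  | cons a l ih =>
    rw [code, ← ih, ← ratEnum_twoInvPow_three_mul, codeIndex, List.foldr_cons, RatIndex.ratEnum_mul,
      RatIndex.ratEnum_add, RatIndex.ratEnum_mk _ _ one_pos]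
    push_cast
    simp [codeIndex]

theorem ratEnum_widthIndex (l : List ℕ) : (ratEnum (widthIndex l) : ℝ) = width l := by
  induction l with
  | nil => simp [widthIndex, width, RatIndex.ratEnum_mk _ _ one_pos]
  | cons a l ih =>
    rw [width, ← ih, ← ratEnum_twoInvPow_three_mul, widthIndex, List.foldr_cons,
      RatIndex.ratEnum_mul]
    push_cast
    simp [widthIndex]

theorem primrec_twoInvPow_three_mul_succ :
    Primrec fun a : ℕ => RatIndex.twoInvPow (3 * (a + 1)) :=
  RatIndex.primrec_twoInvPow.comp (Primrec.nat_mul.comp (.const 3) .succ)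

theorem primrec_codeIndex : Primrec codeIndex := by
  have h : Primrec₂ fun (_ : List ℕ) (v : ℕ × ℕ) =>
      RatIndex.mul (RatIndex.add (RatIndex.mk 4 0 1) v.2) (RatIndex.twoInvPow (3 * (v.1 + 1))) :=
    RatIndex.primrec_mul.comp
      (RatIndex.primrec_add.comp (.const _) (Primrec.snd.comp .snd))
      (primrec_twoInvPow_three_mul_succ.comp (Primrec.fst.comp .snd))
  exact Primrec.list_foldr .id (.const 0) h

theorem primrec_widthIndex : Primrec widthIndex := by
  have h : Primrec₂ fun (_ : List ℕ) (v : ℕ × ℕ) =>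
      RatIndex.mul v.2 (RatIndex.twoInvPow (3 * (v.1 + 1))) :=
    RatIndex.primrec_mul.comp (Primrec.snd.comp .snd)
      (primrec_twoInvPow_three_mul_succ.comp (Primrec.fst.comp .snd))
  exact Primrec.list_foldr .id (.const _) h

/-- Test whether the list coded by `w.unpair.1` has length `n + 1` and its code is close to a real
number, given by an approximation `a` with error at most `2⁻¹ ^ w.unpair.2`. -/
def nearTest (n w a : ℕ) : Bool :=
  decide ((Denumerable.ofNat (List ℕ) w.unpair.1).length = n + 1) &&
    (RatIndex.lt
      (RatIndex.add (RatIndex.sub a (codeIndex (Denumerable.ofNat (List ℕ) w.unpair.1)))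
        (RatIndex.twoInvPow w.unpair.2))
      (RatIndex.add (widthIndex (Denumerable.ofNat (List ℕ) w.unpair.1))
        (widthIndex (Denumerable.ofNat (List ℕ) w.unpair.1))) &&
    RatIndex.lt
      (RatIndex.add (RatIndex.sub (codeIndex (Denumerable.ofNat (List ℕ) w.unpair.1)) a)
        (RatIndex.twoInvPow w.unpair.2))
      (RatIndex.add (widthIndex (Denumerable.ofNat (List ℕ) w.unpair.1))
        (widthIndex (Denumerable.ofNat (List ℕ) w.unpair.1))))

theorem nearTest_iff (n w a : ℕ) :
    nearTest n w a ↔ (Denumerable.ofNat (List ℕ) w.unpair.1).length = n + 1 ∧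
      |(ratEnum a : ℝ) - code (Denumerable.ofNat (List ℕ) w.unpair.1)| + 2⁻¹ ^ w.unpair.2 <
        2 * width (Denumerable.ofNat (List ℕ) w.unpair.1) := by
  simp only [nearTest, Bool.and_eq_true, decide_eq_true_iff, RatIndex.lt_iff,
    ← Rat.cast_lt (K := ℝ), RatIndex.ratEnum_add, RatIndex.ratEnum_sub, RatIndex.ratEnum_twoInvPow]
  push_cast
  rw [ratEnum_codeIndex, ratEnum_widthIndex]
  refine and_congr_right fun _ => ?_
  rw [← lt_sub_iff_add_lt (a := |_|), abs_lt]
  constructor <;> rintro ⟨h1, h2⟩ <;> constructor <;> linarith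

theorem primrec_nearTest : Primrec fun v : ℕ × ℕ × ℕ => nearTest v.1 v.2.1 v.2.2 := by
  have hl : Primrec fun v : ℕ × ℕ × ℕ => Denumerable.ofNat (List ℕ) v.2.1.unpair.1 :=
    (Primrec.ofNat (List ℕ)).comp (Primrec.fst.comp (Primrec.unpair.comp (Primrec.fst.comp .snd)))
  have ha : Primrec fun v : ℕ × ℕ × ℕ => v.2.2 := Primrec.snd.comp .snd
  have hm : Primrec fun v : ℕ × ℕ × ℕ => RatIndex.twoInvPow v.2.1.unpair.2 :=
    RatIndex.primrec_twoInvPow.comp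
      (Primrec.snd.comp (Primrec.unpair.comp (Primrec.fst.comp .snd)))
  have hc := primrec_codeIndex.comp hl
  have hw := primrec_widthIndex.comp hl
  have hww := RatIndex.primrec_add.comp hw hw
  refine Primrec.and.comp (PrimrecPred.decide
    (Primrec.eq.comp (Primrec.list_length.comp hl) (Primrec.succ.comp .fst)))
    (Primrec.and.comp ?_ ?_)
  · exact RatIndex.primrec_lt.comp (RatIndex.primrec_add.comp
      (RatIndex.primrec_sub.comp ha hc) hm) hww
  · exact RatIndex.primrec_lt.comp (RatIndex.primrec_add.comp
      (RatIndex.primrec_sub.comp hc ha) hm) hww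

/-- The functional that decodes a sequence from a name of the limit of the codes of its initial
segments. -/
def decoder (r : Baire) (n : ℕ) : Part ℕ :=
  (Nat.rfind fun w => Part.some (nearTest n w (r w.unpair.2))).map
    fun w => (Denumerable.ofNat (List ℕ) w.unpair.1).getD n 0

theorem recursiveFunctional_decoder : RecursiveFunctional fun r n => decoder r n := by
  refine RecursiveFunctional.search (b := fun w => w.unpair.2)
    (g := fun n w => (Denumerable.ofNat (List ℕ) w.unpair.1).getD n 0)
    (Primrec.snd.comp .unpair).to_comp primrec_nearTest.to_comp (Primrec.to_comp ?_)
  exact (Primrec.list_getD 0).comp ((Primrec.ofNat (List ℕ)).comp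
    (Primrec.fst.comp (Primrec.unpair.comp .snd))) .fst

/-- The test adds the approximation error, so any list it accepts is near `y` itself, and `hv` makes
the result independent of which list is found first. -/
theorem mem_decoder {r : Baire} {y : ℝ} (hr : realRep.Names r y) {n v : ℕ}
    (hex : ∃ l : List ℕ, l.length = n + 1 ∧ |y - code l| < 2 * width l)
    (hv : ∀ l : List ℕ, l.length = n + 1 → |y - code l| < 2 * width l → l.getD n 0 = v) :
    v ∈ decoder r n := by
  have hdist : ∀ m, |(ratEnum (r m) : ℝ) - y| ≤ 2⁻¹ ^ m := fun m => by
    rw [← Real.dist_eq]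
    exact BaireRep.cauchy_dist_le hr m
  have hdom : ∃ w, nearTest n w (r w.unpair.2) := by
    obtain ⟨l, hl, hy⟩ := hex
    -- Half the slack suffices: the error enters once through `r m` and once through the test.
    obtain ⟨m, hm⟩ := exists_pow_lt_of_lt_one (half_pos (sub_pos.2 hy))
      (by norm_num : (2⁻¹ : ℝ) < 1)
    refine ⟨Nat.pair (Encodable.encode l) m, (nearTest_iff _ _ _).2 ?_⟩
    simp only [Nat.unpair_pair, Denumerable.ofNat_encode]
    refine ⟨hl, ?_⟩
    have := abs_sub_le (ratEnum (r m) : ℝ) y (code l)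
    have := hdist m
    linarith
  obtain ⟨w₀, hw₀⟩ := hdom
  obtain ⟨w, hw, -⟩ := Nat.rfind_min' (p := fun w => nearTest n w (r w.unpair.2)) hw₀
  refine (Part.mem_map_iff _).2 ⟨w, hw, ?_⟩
  have hT : nearTest n w (r w.unpair.2) = true := (Part.mem_some_iff.1 (Nat.rfind_spec hw)).symm
  obtain ⟨hl, hlt⟩ := (nearTest_iff _ _ _).1 hT
  refine hv _ hl ?_
  have h1 := abs_sub_le y (ratEnum (r w.unpair.2) : ℝ)
    (code (Denumerable.ofNat (List ℕ) w.unpair.1))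
  have h2 := hdist w.unpair.2
  rw [abs_sub_comm] at h2
  linarith

end ListCode

/-- A problem reduces strongly to `bwtReal` if a name of the input computes a pointwise bounded
sequence in Baire space, all whose cluster points are names of solutions. -/
theorem strongReducible_bwtReal {X Y : Type*} {f : MultiFunction X Y} {P : Baire → ℕ → ℕ → ℕ}
    (hP : RecursiveFunctional fun p k =>
      Part.some (ListCode.codeIndex ((List.range k.unpair.1).map (P p k.unpair.1))))
    (hbdd : ∀ p x, f.source.Names p x → x ∈ f.dom → ∀ i, ∃ B, ∀ s, P p s i ≤ B)
    (hclust : ∀ p x, f.source.Names p x → x ∈ f.dom → ∀ q : ℕ → ℕ,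
      (∀ i j, ∃ᶠ s in atTop, P p s i = q i ∧ P p s j = q j) →
        ∃ y ∈ f.values x, f.target.Names q y) :
    MultiFunction.StrongReducible f bwtReal := by
  refine .of_functional hP ListCode.recursiveFunctional_decoder fun p x hp hx => ?_
  let e : ℕ → ℝ := fun s => ListCode.code ((List.range s).map (P p s))
  have he : ∀ s, e s ∈ Set.Icc (0 : ℝ) 1 := fun s =>
    ⟨ListCode.code_nonneg _, ListCode.code_le_one _⟩
  have hcomp : IsCompact (closure (Set.range e)) :=
    isCompact_Icc.closure_of_subset (Set.range_subset_iff.2 he)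
  refine ⟨e, ?_, fun s => ?_, fun y hy r hr => ?_⟩
  · obtain ⟨y, -, hy⟩ := isCompact_Icc.exists_mapClusterPt
      (Filter.tendsto_principal.2 (Filter.Eventually.of_forall (f := atTop) he))
    exact ⟨y, hcomp, hy⟩
  -- The terms of `e` are rational, so each has a constant name.
  · have hs : (fun j : ℕ => ListCode.codeIndex ((List.range (Nat.pair s j).unpair.1).map
        (P p (Nat.pair s j).unpair.1))) =
        fun _ => ListCode.codeIndex ((List.range s).map (P p s)) := by
      funext j
      simp
    rw [hs]
    refine ⟨fun i j _ => ?_, ?_⟩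
    · rw [dist_self]
      positivity
    · simp only [ListCode.ratEnum_codeIndex]
      exact tendsto_const_nhds
  · obtain ⟨q, h1, h2, h3⟩ := ListCode.exists_cluster_of_mapClusterPt (hbdd p x hp hx) hy.2
    obtain ⟨z, hz, hq⟩ := hclust p x hp hx q h3
    exact ⟨q, z, fun n => ListCode.mem_decoder hr (h1 n) (h2 n), hz, hq⟩

/-! ### The projection operator reduces to the Bolzano-Weierstraß operator -/

section NearlyNearest

variable {X : Type*} [MetricSpace X] {α : ℕ → X}

/-- A quantity for the basic ball with index `k` which, when the ball meets a set `A`, exceeds the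
squared distance of `x` and `A` by at least the radius of the ball. -/
noncomputable def ballWeight (α : ℕ → X) (x : X) (k : ℕ) : ℝ :=
  dist x (α k.unpair.1) ^ 2 + nonnegRatEnum k.unpair.2 * dist x (α k.unpair.1) ^ 2 +
    nonnegRatEnum k.unpair.2 ^ 2 + 2 * nonnegRatEnum k.unpair.2

theorem nonnegRatEnum_nonneg (m : ℕ) : (0 : ℝ) ≤ nonnegRatEnum m := by
  unfold nonnegRatEnum
  push_cast
  positivity

/-- With `t` the distance to the centre and `r` the radius, the distance to `A` is at most `t + r`,
and `2rt ≤ r(t² + 1)` bounds `(t + r)² + r` by the weight. This trades `t` for `t²`, which is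
rational at rational points. -/
theorem infDist_sq_add_le_ballWeight {A : Set X} {k : ℕ} (h : (basicBall α k ∩ A).Nonempty)
    (x : X) : Metric.infDist x A ^ 2 + nonnegRatEnum k.unpair.2 ≤ ballWeight α x k := by
  obtain ⟨z, hz, hzA⟩ := h
  have hz' : dist z (α k.unpair.1) < nonnegRatEnum k.unpair.2 := hz
  have h1 : Metric.infDist x A ≤ dist x (α k.unpair.1) + nonnegRatEnum k.unpair.2 := by
    have := Metric.infDist_le_dist_of_mem (x := x) hzA
    have := dist_triangle_right x z (α k.unpair.1)
    linarith
  have h2 := pow_le_pow_left₀ Metric.infDist_nonneg h1 2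
  have h3 := nonnegRatEnum_nonneg k.unpair.2
  have h4 := mul_nonneg h3 (sq_nonneg (dist x (α k.unpair.1) - 1))
  unfold ballWeight
  linarith

theorem exists_ballWeight_lt (hα : DenseRange α) {A : Set X} (hA : A.Nonempty) (x : X) {ε : ℝ}
    (hε : 0 < ε) :
    ∃ k, (basicBall α k ∩ A).Nonempty ∧ ballWeight α x k < Metric.infDist x A ^ 2 + ε := by
  set D := Metric.infDist x A
  -- One `ρ` reaches a nearly nearest point of `A`, the other a centre in the dense sequence; at `ρ
  -- = 0` the expression is `D ^ 2`.
  have hcont : ContinuousAt (fun ρ : ℝ => (D + 2 * ρ) ^ 2 + ρ * (D + 2 * ρ) ^ 2 + ρ ^ 2 + 2 * ρ) 0 :=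
    by fun_prop
  have hlt : ∀ᶠ ρ : ℝ in 𝓝 0,
      (D + 2 * ρ) ^ 2 + ρ * (D + 2 * ρ) ^ 2 + ρ ^ 2 + 2 * ρ < D ^ 2 + ε :=
    hcont.eventually_lt_const (by simpa using hε)
  obtain ⟨η, hη, hball⟩ := Metric.eventually_nhds_iff.1 hlt
  obtain ⟨m, hm0, hm⟩ := exists_nonnegRatEnum_between hη
  obtain ⟨a, haA, ha⟩ := (Metric.infDist_lt_iff hA).1 (lt_add_of_pos_right D hm0)
  obtain ⟨j, hj⟩ := hα.exists_dist_lt a hm0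
  refine ⟨Nat.pair j m, ⟨a, by simpa [basicBall] using hj, haA⟩, ?_⟩
  have h1 : dist x (α j) ≤ D + 2 * nonnegRatEnum m := by
    have := dist_triangle x a (α j)
    linarith
  have h2 := pow_le_pow_left₀ dist_nonneg h1 2
  have h3 := mul_le_mul_of_nonneg_left h2 hm0.le
  have h4 := hball (y := (nonnegRatEnum m : ℝ)) (by rwa [Real.dist_eq, sub_zero, abs_of_pos hm0])
  unfold ballWeight
  rw [Nat.unpair_pair]
  linarith

theorem continuous_ballWeight (k : ℕ) : Continuous fun x => ballWeight α x k := by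
  unfold ballWeight
  fun_prop

variable {A : Set X} {x : X} {u : ℕ → X} {k : ℕ → ℕ}

/-- The centres of basic balls that meet `A` and have asymptotically least weight approach `A`, and
their distances to `x` approach the distance of `x` and `A`. -/
theorem tendsto_of_ballWeight_le (hα : DenseRange α) (hA : A.Nonempty)
    (hu : Tendsto u atTop (𝓝 x)) (hk : ∀ᶠ s in atTop, (basicBall α (k s) ∩ A).Nonempty)
    (hmin : ∀ j, (basicBall α j ∩ A).Nonempty →
      ∀ᶠ s in atTop, ballWeight α (u s) (k s) ≤ ballWeight α (u s) j) :
    Tendsto (fun s => dist x (α (k s).unpair.1)) atTop (𝓝 (Metric.infDist x A)) ∧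
      Tendsto (fun s => Metric.infDist (α (k s).unpair.1) A) atTop (𝓝 0) := by
  set D := Metric.infDist x A
  have hD : Tendsto (fun s => Metric.infDist (u s) A ^ 2) atTop (𝓝 (D ^ 2)) :=
    (((Metric.continuous_infDist_pt A).tendsto x).comp hu).pow 2
  have hlow := hk.mono fun s hs => infDist_sq_add_le_ballWeight hs (u s)
  -- The squared distance bounds the weights from below; any fixed, nearly optimal ball eventually
  -- bounds them from above.
  have hW : Tendsto (fun s => ballWeight α (u s) (k s)) atTop (𝓝 (D ^ 2)) := by
    refine tendsto_order.2 ⟨fun a ha => ?_, fun a ha => ?_⟩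
    · filter_upwards [hlow, hD.eventually_const_lt ha] with s h1 h2
      have := nonnegRatEnum_nonneg (k s).unpair.2
      linarith
    · obtain ⟨j, hj, hja⟩ := exists_ballWeight_lt hα hA x (sub_pos.2 ha)
      rw [add_sub_cancel] at hja
      have := ((continuous_ballWeight (α := α) j).tendsto x).comp hu
      filter_upwards [hmin j hj, this.eventually_lt_const hja] with s h1 h2
      exact h1.trans_lt h2
  -- The excess of the weight over the squared distance dominates the radius.
  have hr : Tendsto (fun s => (nonnegRatEnum (k s).unpair.2 : ℝ)) atTop (𝓝 0) := by
    have h := hW.sub hD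
    rw [sub_self] at h
    refine squeeze_zero' (Eventually.of_forall fun s => nonnegRatEnum_nonneg _)
      (hlow.mono fun s hs => ?_) h
    linarith
  have hrt : Tendsto (fun s => (nonnegRatEnum (k s).unpair.2 : ℝ) *
      dist (u s) (α (k s).unpair.1) ^ 2) atTop (𝓝 0) := by
    have h := hr.mul hW
    rw [zero_mul] at h
    refine squeeze_zero (fun s => mul_nonneg (nonnegRatEnum_nonneg _) (sq_nonneg _))
      (fun s => mul_le_mul_of_nonneg_left ?_ (nonnegRatEnum_nonneg _)) h
    have h1 := nonnegRatEnum_nonneg (k s).unpair.2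
    have h2 := mul_nonneg h1 (sq_nonneg (dist (u s) (α (k s).unpair.1)))
    unfold ballWeight
    nlinarith
  have ht2 : Tendsto (fun s => dist (u s) (α (k s).unpair.1) ^ 2) atTop (𝓝 (D ^ 2)) := by
    have h := ((hW.sub hrt).sub (hr.pow 2)).sub (hr.const_mul 2)
    simp only [ne_eq, OfNat.ofNat_ne_zero, not_false_eq_true, zero_pow, mul_zero, sub_zero] at h
    refine h.congr fun s => ?_
    unfold ballWeight
    ring
  have ht : Tendsto (fun s => dist (u s) (α (k s).unpair.1)) atTop (𝓝 D) := by
    have h := ht2.sqrt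
    simpa only [Real.sqrt_sq dist_nonneg, D, Real.sqrt_sq Metric.infDist_nonneg] using h
  constructor
  · have hd : Tendsto (fun s => dist x (α (k s).unpair.1) - dist (u s) (α (k s).unpair.1))
        atTop (𝓝 0) := by
      refine squeeze_zero_norm (fun s => ?_) (tendsto_iff_dist_tendsto_zero.1 hu)
      rw [Real.norm_eq_abs, dist_comm (u s) x]
      exact abs_dist_sub_le x (u s) (α (k s).unpair.1)
    simpa using hd.add ht
  · refine squeeze_zero' (Eventually.of_forall fun s => Metric.infDist_nonneg)
      (hk.mono fun s hs => ?_) hr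
    obtain ⟨z, hz, hzA⟩ := hs
    have hz' : dist z (α (k s).unpair.1) < nonnegRatEnum (k s).unpair.2 := hz
    rw [dist_comm] at hz'
    exact (Metric.infDist_le_dist_of_mem hzA).trans hz'.le

theorem nearest_of_mapClusterPt {c : ℕ → X} {y : X} (hAc : IsClosed A) (hA : A.Nonempty)
    (hdist : Tendsto (fun s => dist x (c s)) atTop (𝓝 (Metric.infDist x A)))
    (hinf : Tendsto (fun s => Metric.infDist (c s) A) atTop (𝓝 0))
    (hy : MapClusterPt y atTop c) : y ∈ A ∧ dist x y = Metric.infDist x A := by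
  obtain ⟨φ, hφ, hlim⟩ := hy.tendsto_subseq
  constructor
  · rw [hAc.mem_iff_infDist_zero hA]
    exact tendsto_nhds_unique (((Metric.continuous_infDist_pt A).tendsto y).comp hlim)
      (hinf.comp hφ.tendsto_atTop)
  · exact tendsto_nhds_unique (tendsto_const_nhds.dist hlim) (hdist.comp hφ.tendsto_atTop)

end NearlyNearest

/-! ### Computing nearly nearest rational vectors from positive information. -/

namespace PosProjection

open RatIndex

/-- The least index of a rational vector at distance less than `2⁻¹ ^ (i + 2)` from the `c`-th
one. -/
def approx (n c i : ℕ) : ℕ :=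
  Nat.find (p := fun j => lt (distSq n j c) (twoInvPow (2 * (i + 2))) = true) ⟨c, by
    rw [lt_iff, ← Rat.cast_lt (K := ℝ), ratEnum_distSq, ratEnum_twoInvPow, dist_self,
      zero_pow two_ne_zero]
    push_cast
    positivity⟩

theorem lt_distSq_iff (n j c i : ℕ) : lt (distSq n j c) (twoInvPow (2 * (i + 2))) = true ↔
    dist (ratVecEnum n j) (ratVecEnum n c) < 2⁻¹ ^ (i + 2) := by
  rw [lt_iff, ← Rat.cast_lt (K := ℝ), ratEnum_distSq, ratEnum_twoInvPow, mul_comm 2, pow_mul]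
  push_cast
  exact pow_lt_pow_iff_left₀ dist_nonneg (by positivity) two_ne_zero

theorem dist_approx_lt (n c i : ℕ) :
    dist (ratVecEnum n (approx n c i)) (ratVecEnum n c) < 2⁻¹ ^ (i + 2) :=
  (lt_distSq_iff _ _ _ _).1 (Nat.find_spec (p := fun j => lt (distSq n j c) _ = true) _)

theorem approx_le {n c i j : ℕ} (h : dist (ratVecEnum n j) (ratVecEnum n c) < 2⁻¹ ^ (i + 2)) :
    approx n c i ≤ j :=
  Nat.find_min' _ ((lt_distSq_iff _ _ _ _).2 h)

theorem computable_approx (n : ℕ) : Computable₂ (approx n) := by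
  have hT : Computable₂ fun (v : ℕ × ℕ) (j : ℕ) =>
      lt (distSq n j v.1) (twoInvPow (2 * (v.2 + 2))) := by
    refine Primrec.to_comp (primrec_lt.comp
      ((primrec_distSq n).comp .snd (Primrec.fst.comp .fst)) (primrec_twoInvPow.comp
        (Primrec.nat_double.comp (Primrec.nat_add.comp (Primrec.snd.comp .fst) (.const 2)))))
  refine (Partrec.rfind hT.partrec₂).of_eq_tot fun v => Nat.mem_rfind.2 ⟨?_, fun {m} hm => ?_⟩
  · exact Part.mem_some_iff.2
      (Nat.find_spec (p := fun j => lt (distSq n j v.1) (twoInvPow (2 * (v.2 + 2))) = true) _).symm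
  · exact Part.mem_some_iff.2 (Bool.eq_false_iff.2 (Nat.find_min _ hm)).symm

/-- For a bounded sequence of rational vectors, `approx` is bounded. -/
theorem exists_approx_le {n : ℕ} {c : ℕ → ℕ}
    (hc : Bornology.IsBounded (Set.range fun s => ratVecEnum n (c s))) (i : ℕ) :
    ∃ B, ∀ s, approx n (c s) i ≤ B := by
  -- Finitely many balls about rational vectors cover the range; the largest of their indices bounds
  -- every least index.
  obtain ⟨t, ht⟩ := hc.isCompact_closure.elim_finite_subcover
    (fun j => Metric.ball (ratVecEnum n j) (2⁻¹ ^ (i + 2))) (fun _ => Metric.isOpen_ball)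
    fun y _ => by
      obtain ⟨j, hj⟩ := (denseRange_ratVecEnum n).exists_dist_lt y
        (by positivity : (0 : ℝ) < 2⁻¹ ^ (i + 2))
      exact Set.mem_iUnion.2 ⟨j, hj⟩
  refine ⟨t.sup id, fun s => ?_⟩
  obtain ⟨j, hjt, hj⟩ := Set.mem_iUnion₂.1 (ht (subset_closure (Set.mem_range_self s)))
  rw [Metric.mem_ball, dist_comm] at hj
  exact (approx_le hj).trans (Finset.le_sup (f := id) hjt)

/-- An index of the weight of the `k`-th basic ball for the `x`-th rational vector. -/
def weight (n x k : ℕ) : ℕ :=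
  add (add (add (distSq n x k.unpair.1) (mul (ofNonneg k.unpair.2) (distSq n x k.unpair.1)))
    (sq (ofNonneg k.unpair.2))) (add (ofNonneg k.unpair.2) (ofNonneg k.unpair.2))

theorem ratEnum_weight (n x k : ℕ) :
    (ratEnum (weight n x k) : ℝ) = ballWeight (ratVecEnum n) (ratVecEnum n x) k := by
  simp only [weight, ratEnum_add, ratEnum_mul, ratEnum_sq, ratEnum_ofNonneg, ballWeight]
  push_cast
  rw [ratEnum_distSq]
  ring

theorem primrec_weight (n : ℕ) : Primrec₂ (weight n) := by
  have hc : Primrec fun v : ℕ × ℕ => distSq n v.1 v.2.unpair.1 :=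
    (primrec_distSq n).comp .fst (Primrec.fst.comp (Primrec.unpair.comp .snd))
  have hr : Primrec fun v : ℕ × ℕ => ofNonneg v.2.unpair.2 :=
    primrec_ofNonneg.comp (Primrec.snd.comp (Primrec.unpair.comp .snd))
  exact primrec_add.comp (primrec_add.comp (primrec_add.comp hc (primrec_mul.comp hr hc))
    (primrec_sq.comp hr)) (primrec_add.comp hr hr)

/-- Of two entries of an enumeration of basic balls, the one of smaller weight. The entry `0` lists
nothing. -/
def better (n x e b : ℕ) : ℕ :=
  if e = 0 then b else if b = 0 then e
  else if lt (weight n x (e - 1)) (weight n x (b - 1)) = true then e else b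

theorem primrec_better (n : ℕ) :
    Primrec fun v : ℕ × ℕ × ℕ => better n v.1 v.2.1 v.2.2 := by
  have he : Primrec fun v : ℕ × ℕ × ℕ => v.2.1 := Primrec.fst.comp .snd
  have hb : Primrec fun v : ℕ × ℕ × ℕ => v.2.2 := Primrec.snd.comp .snd
  have hwe : Primrec fun v : ℕ × ℕ × ℕ => weight n v.1 (v.2.1 - 1) :=
    (primrec_weight n).comp .fst (Primrec.pred.comp he)
  have hwb : Primrec fun v : ℕ × ℕ × ℕ => weight n v.1 (v.2.2 - 1) :=
    (primrec_weight n).comp .fst (Primrec.pred.comp hb)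
  exact Primrec.ite (Primrec.eq.comp he (.const 0)) hb
    (Primrec.ite (Primrec.eq.comp hb (.const 0)) he
      (Primrec.ite (Primrec.eq.comp (primrec_lt.comp hwe hwb) (.const true)) he hb))

/-- The best among the first `s` entries of an enumeration of basic balls. -/
def bestEntry (n x : ℕ) (e : ℕ → ℕ) : ℕ → ℕ
  | 0 => 0
  | s + 1 => better n x (e s) (bestEntry n x e s)

theorem bestEntry_congr (n x : ℕ) {e e' : ℕ → ℕ} {s : ℕ} (h : ∀ i < s, e i = e' i) :
    bestEntry n x e s = bestEntry n x e' s := by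
  induction s with
  | zero => rfl
  | succ s ih => rw [bestEntry, bestEntry, h s s.lt_succ_self, ih fun i hi => h i (by omega)]

theorem bestEntry_mem (n x : ℕ) (e : ℕ → ℕ) (s : ℕ) (h : bestEntry n x e s ≠ 0) :
    ∃ i, e i = bestEntry n x e s := by
  induction s with
  | zero => exact absurd rfl h
  | succ s ih =>
    unfold bestEntry better at h ⊢
    split_ifs with h1 h2 h3
    · exact ih (by simpa [h1] using h)
    · exact ⟨s, rfl⟩
    · exact ⟨s, rfl⟩
    · exact ih h2

/-- The approximation of the point changes with the stage, so minimality is needed over all `s`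
entries for each fixed `x`: the search restarts at every stage. -/
theorem bestEntry_le (n x : ℕ) (e : ℕ → ℕ) {i s : ℕ} (hi : i < s) (he : e i ≠ 0) :
    bestEntry n x e s ≠ 0 ∧ ballWeight (ratVecEnum n) (ratVecEnum n x) (bestEntry n x e s - 1) ≤
      ballWeight (ratVecEnum n) (ratVecEnum n x) (e i - 1) := by
  simp only [← ratEnum_weight, Rat.cast_le]
  induction s with
  | zero => omega
  | succ s ih =>
    rw [bestEntry]
    unfold better
    rcases Nat.lt_succ_iff_lt_or_eq.1 hi with h | rfl
    · obtain ⟨h1, h2⟩ := ih h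
      split_ifs with h3 h4
      · exact ⟨h1, h2⟩
      · exact ⟨h3, ((lt_iff _ _).1 h4).le.trans h2⟩
      · exact ⟨h1, h2⟩
    · rw [if_neg he]
      split_ifs with h2 h3
      · exact ⟨he, le_rfl⟩
      · exact ⟨he, le_rfl⟩
      · exact ⟨h2, not_lt.1 fun h => h3 ((lt_iff _ _).2 h)⟩

/-- The centre of the best basic ball found after `s` steps, given a name of a point and of a
set. -/
def bestCenter (n : ℕ) (p : Baire) (s : ℕ) : ℕ :=
  (bestEntry n (p (2 * s)) (fun i => p (2 * i + 1)) s - 1).unpair.1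

theorem primrec_bestCenter (n : ℕ) :
    Primrec₂ fun (u : List ℕ) (s : ℕ) => bestCenter n (fun i => u.getD i 0) s := by
  have hx : Primrec fun v : List ℕ × ℕ => v.1.getD (2 * v.2) 0 :=
    (Primrec.list_getD 0).comp .fst (Primrec.nat_double.comp .snd)
  have he : Primrec fun w : (List ℕ × ℕ) × ℕ × ℕ => w.1.1.getD (2 * w.2.1 + 1) 0 :=
    (Primrec.list_getD 0).comp (Primrec.fst.comp .fst)
      (Primrec.nat_double_succ.comp (Primrec.fst.comp .snd))
  have hstep : Primrec₂ fun (v : List ℕ × ℕ) (w : ℕ × ℕ) =>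
      better n (v.1.getD (2 * v.2) 0) (v.1.getD (2 * w.1 + 1) 0) w.2 :=
    (primrec_better n).comp ((hx.comp .fst).pair (he.pair (Primrec.snd.comp .snd)))
  have hrec := Primrec.nat_rec' (f := fun v : List ℕ × ℕ => v.2) Primrec.snd (.const 0) hstep
  have hbest : Primrec fun v : List ℕ × ℕ =>
      bestEntry n (v.1.getD (2 * v.2) 0) (fun i => v.1.getD (2 * i + 1) 0) v.2 := by
    refine hrec.of_eq fun v => ?_
    obtain ⟨u, s⟩ := v
    dsimp only
    generalize u.getD (2 * s) 0 = x
    induction s with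
    | zero => rfl
    | succ s ih => rw [bestEntry, ← ih]
  exact Primrec.fst.comp (Primrec.unpair.comp (Primrec.pred.comp hbest))

/-- Only the even place `2 * s` and the odd places below it are read. -/
theorem bestCenter_initialSegment (n : ℕ) (p : Baire) (s : ℕ) :
    bestCenter n (fun i => ((List.range (2 * s + 1)).map p).getD i 0) s = bestCenter n p s := by
  have hget : ∀ i, i < 2 * s + 1 → ((List.range (2 * s + 1)).map p).getD i 0 = p i := by
    intro i hi
    simp [List.getD, hi]
  unfold bestCenter
  dsimp only
  rw [hget _ (by omega), bestEntry_congr (e' := fun i => p (2 * i + 1))]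
  intro i hi
  exact hget _ (by omega)

theorem recursiveFunctional_codeIndex (n : ℕ) : RecursiveFunctional fun p k =>
    Part.some (ListCode.codeIndex ((List.range k.unpair.1).map
      fun i => approx n (bestCenter n p k.unpair.1) i)) := by
  have hs : Computable fun v : List ℕ × ℕ => v.2.unpair.1 :=
    (Primrec.fst.comp (Primrec.unpair.comp .snd)).to_comp
  have hc : Computable fun v : List ℕ × ℕ =>
      bestCenter n (fun i => v.1.getD i 0) v.2.unpair.1 :=
    (primrec_bestCenter n).to_comp.comp .fst hs
  have hstep : Computable₂ fun (v : List ℕ × ℕ) (w : ℕ × List ℕ) =>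
      w.2 ++ [approx n (bestCenter n (fun i => v.1.getD i 0) v.2.unpair.1) w.1] :=
    Computable.list_concat.comp (Computable.snd.comp .snd)
      ((computable_approx n).comp (hc.comp .fst) (Computable.fst.comp .snd))
  have hlist : Computable fun v : List ℕ × ℕ => (List.range v.2.unpair.1).map
      fun i => approx n (bestCenter n (fun i => v.1.getD i 0) v.2.unpair.1) i := by
    refine (Computable.nat_rec hs (Computable.const []) hstep).of_eq fun v => ?_
    generalize bestCenter n (fun i => v.1.getD i 0) v.2.unpair.1 = c
    induction v.2.unpair.1 with
    | zero => rfl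
    | succ s ih => simp [ih, List.range_succ]
  have hlen : Computable fun k : ℕ => 2 * k.unpair.1 + 1 :=
    (Primrec.nat_double_succ.comp (Primrec.fst.comp .unpair)).to_comp
  refine (RecursiveFunctional.of_initialSegment hlen (f := fun u k =>
    ListCode.codeIndex ((List.range k.unpair.1).map
      fun i => approx n (bestCenter n (fun i => u.getD i 0) k.unpair.1) i))
    (ListCode.primrec_codeIndex.to_comp.comp hlist)).of_eq fun p k => ?_
  rw [bestCenter_initialSegment]

/-- The centres of the best balls approach the set, and their distances to the point approach the
distance of the point and the set. -/
theorem tendsto_bestCenter {n : ℕ} {p : Baire}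
    {z : EuclideanSpace ℝ (Fin n) × TopologicalSpace.Closeds (EuclideanSpace ℝ (Fin n))}
    (hp : (projPos n).source.Names p z) (hz : (z.2 : Set (EuclideanSpace ℝ (Fin n))).Nonempty) :
    Tendsto (fun s => dist z.1 (ratVecEnum n (bestCenter n p s))) atTop
        (𝓝 (Metric.infDist z.1 z.2)) ∧
      Tendsto (fun s => Metric.infDist (ratVecEnum n (bestCenter n p s)) z.2) atTop (𝓝 0) := by
  obtain ⟨hx, hA⟩ := hp
  refine tendsto_of_ballWeight_le (u := fun s => ratVecEnum n (p (2 * s)))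
    -- The entry `k + 1` lists the ball `k`. While nothing has been listed the subtraction gives the
    -- ball `0`, which need not meet the set; hence the claims hold only eventually.
    (k := fun s => bestEntry n (p (2 * s)) (fun i => p (2 * i + 1)) s - 1)
    (denseRange_ratVecEnum n) hz hx.2 ?_ fun j hj => ?_
  · obtain ⟨k, hk, -⟩ := exists_ballWeight_lt (denseRange_ratVecEnum n) hz z.1 one_pos
    obtain ⟨i, hi⟩ := (hA k).2 hk
    filter_upwards [eventually_gt_atTop i] with s hs
    have hne := (bestEntry_le n (p (2 * s)) (fun i => p (2 * i + 1)) hs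
      (by dsimp only at hi ⊢; omega)).1
    obtain ⟨i', hi'⟩ := bestEntry_mem n (p (2 * s)) (fun i => p (2 * i + 1)) s hne
    exact (hA _).1 ⟨i', hi'.trans (Nat.succ_pred_eq_of_ne_zero hne).symm⟩
  · obtain ⟨i, hi⟩ := (hA j).2 hj
    filter_upwards [eventually_gt_atTop i] with s hs
    have := (bestEntry_le n (p (2 * s)) (fun i => p (2 * i + 1)) hs
      (by dsimp only at hi ⊢; omega)).2
    dsimp only at hi this
    rwa [hi, Nat.add_sub_cancel] at this

/-- A sequence of indices, any two entries of which are infinitely often the approximations of the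
same term of a sequence, is a name of a cluster point of that sequence. -/
theorem exists_mapClusterPt_names {n : ℕ} {c : ℕ → ℕ} {q : ℕ → ℕ}
    (hq : ∀ i j, ∃ᶠ s in atTop, approx n (c s) i = q i ∧ approx n (c s) j = q j) :
    ∃ y, MapClusterPt y atTop (fun s => ratVecEnum n (c s)) ∧ (euclideanRep n).Names q y := by
  have hdist : ∀ i j, i ≤ j →
      dist (ratVecEnum n (q i)) (ratVecEnum n (q j)) ≤ (2 : ℝ)⁻¹ ^ i := by
    intro i j hij
    -- A common `s` puts both vectors near the same term; this is why entries are controlled in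
    -- pairs.
    obtain ⟨s, hi, hj⟩ := (hq i j).exists
    have h1 := dist_approx_lt n (c s) i
    have h2 := dist_approx_lt n (c s) j
    rw [hi] at h1
    rw [hj] at h2
    have h3 : (2⁻¹ : ℝ) ^ (j + 2) ≤ 2⁻¹ ^ (i + 2) :=
      pow_le_pow_of_le_one (by norm_num) (by norm_num) (by omega)
    have h4 : (2⁻¹ : ℝ) ^ (i + 2) = 2⁻¹ ^ i / 4 := by rw [pow_add]; norm_num; ring
    have h5 : (0 : ℝ) < 2⁻¹ ^ i := by positivity
    have := dist_triangle_right (ratVecEnum n (q i)) (ratVecEnum n (q j)) (ratVecEnum n (c s))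
    linarith
  have hlim : Tendsto (fun i : ℕ => (2 : ℝ)⁻¹ ^ i) atTop (𝓝 0) :=
    tendsto_pow_atTop_nhds_zero_of_lt_one (by norm_num) (by norm_num)
  obtain ⟨y, hy⟩ := cauchySeq_tendsto_of_complete
    (cauchySeq_of_le_tendsto_0' (s := fun i => ratVecEnum n (q i)) _ hdist hlim)
  have hname : (euclideanRep n).Names q y := ⟨hdist, hy⟩
  refine ⟨y, ?_, hname⟩
  rw [mapClusterPt_iff_frequently]
  intro U hU
  obtain ⟨ε, hε, hεU⟩ := Metric.mem_nhds_iff.1 hU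
  obtain ⟨i, hi⟩ := (hlim.eventually_lt_const (half_pos hε)).exists
  refine (hq i i).mono fun s hs => hεU ?_
  have h1 := dist_approx_lt n (c s) i
  rw [hs.1] at h1
  have h2 := BaireRep.cauchy_dist_le hname i
  have h3 : (2⁻¹ : ℝ) ^ (i + 2) ≤ 2⁻¹ ^ i :=
    pow_le_pow_of_le_one (by norm_num) (by norm_num) (by omega)
  rw [Metric.mem_ball]
  have := dist_triangle_left (ratVecEnum n (c s)) y (ratVecEnum n (q i))
  linarith

end PosProjection

theorem projPos_strongReducible_bwtReal (n : ℕ) :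
    MultiFunction.StrongReducible (projPos n) bwtReal := by
  refine strongReducible_bwtReal
    (P := fun p s i => PosProjection.approx n (PosProjection.bestCenter n p s) i)
    (PosProjection.recursiveFunctional_codeIndex n) (fun p z hp hz i => ?_)
    fun p z hp hz q hq => ?_
  · obtain ⟨y, hy, -⟩ := hz
    -- A convergent sequence is bounded as a whole, including the stages at which no ball has been
    -- found.
    obtain ⟨B, hB⟩ := (PosProjection.tendsto_bestCenter hp ⟨y, hy⟩).1.bddAbove_range
    refine PosProjection.exists_approx_le
      ((Metric.isBounded_closedBall (x := z.1) (r := B)).subset ?_) i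
    rintro _ ⟨s, rfl⟩
    rw [Metric.mem_closedBall']
    exact hB (Set.mem_range_self s)
  · obtain ⟨a, ha, -⟩ := hz
    obtain ⟨hdist, hinf⟩ := PosProjection.tendsto_bestCenter hp ⟨a, ha⟩
    obtain ⟨y, hy, hqy⟩ := PosProjection.exists_mapClusterPt_names hq
    exact ⟨y, nearest_of_mapClusterPt z.2.isClosed ⟨a, ha⟩ hdist hinf hy, hqy⟩

/-! ### The Bolzano-Weierstraß operator reduces to the projection operator -/

theorem BaireRep.cauchy_names_of_dist_le {X : Type*} [MetricSpace X] {α : ℕ → X}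
    {hα : DenseRange α} {q : Baire} {x : X} (h : ∀ i, dist (α (q i)) x ≤ (2 : ℝ)⁻¹ ^ (i + 1)) :
    (BaireRep.cauchy α hα).Names q x := by
  refine ⟨fun i j hij => ?_, ?_⟩
  · have h1 : (2 : ℝ)⁻¹ ^ (j + 1) ≤ 2⁻¹ ^ (i + 1) :=
      pow_le_pow_of_le_one (by norm_num) (by norm_num) (by omega)
    have h2 : (2 : ℝ)⁻¹ ^ (i + 1) = 2⁻¹ ^ i / 2 := by rw [pow_succ]; ring
    have := dist_triangle_right (α (q i)) (α (q j)) x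
    linarith [h i, h j]
  · rw [tendsto_iff_dist_tendsto_zero]
    exact squeeze_zero (fun _ => dist_nonneg) h
      ((tendsto_pow_atTop_nhds_zero_of_lt_one (by norm_num) (by norm_num)).comp
        (tendsto_add_atTop_nat 1))

/-- Any finite set of terms misses `y` and is closed, so it can be removed from a neighbourhood of
`y`, which then meets only later terms. -/
theorem mapClusterPt_of_mem_closure_range {X : Type*} [TopologicalSpace X] [T1Space X]
    {v : ℕ → X} {y : X} (hy : y ∈ closure (Set.range v)) (hne : ∀ s, v s ≠ y) :
    MapClusterPt y atTop v := by
  rw [mapClusterPt_iff_frequently]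
  intro U hU hev
  obtain ⟨N, hN⟩ := eventually_atTop.1 hev
  have hfin : (v '' Set.Iio N).Finite := (Set.finite_Iio N).image v
  have hV : (v '' Set.Iio N)ᶜ ∈ 𝓝 y :=
    hfin.isClosed.isOpen_compl.mem_nhds fun ⟨s, _, hs⟩ => hne s hs
  obtain ⟨_, ⟨hzU, hzV⟩, s, rfl⟩ := mem_closure_iff_nhds.1 hy _ (inter_mem hU hV)
  rcases lt_or_ge s N with h | h
  · exact hzV ⟨s, h, rfl⟩
  · exact hN s h hzU

/-- The rational parametrization of the unit circle in the plane of the first two coordinates. -/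
noncomputable def circlePoint (n : ℕ) (t : ℝ) : EuclideanSpace ℝ (Fin n) :=
  WithLp.toLp 2 fun i =>
    if (i : ℕ) = 0 then (1 - t ^ 2) / (1 + t ^ 2)
    else if (i : ℕ) = 1 then 2 * t / (1 + t ^ 2) else 0

theorem one_add_sq_pos (t : ℝ) : 0 < 1 + t ^ 2 := by positivity

theorem continuous_circlePoint (n : ℕ) : Continuous (circlePoint n) := by
  refine (PiLp.continuous_toLp 2 _).comp (continuous_pi fun i => ?_)
  have h : ∀ t : ℝ, 1 + t ^ 2 ≠ 0 := fun t => (one_add_sq_pos t).ne'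
  split_ifs
  · exact Continuous.div (by fun_prop) (by fun_prop) h
  · exact Continuous.div (by fun_prop) (by fun_prop) h
  · exact continuous_const

theorem norm_circlePoint {n : ℕ} (hn : 2 ≤ n) (t : ℝ) : ‖circlePoint n t‖ = 1 := by
  obtain ⟨m, rfl⟩ := Nat.exists_eq_add_of_le' hn
  have h := one_add_sq_pos t
  have hsq : ‖circlePoint (m + 2) t‖ ^ 2 = 1 := by
    rw [EuclideanSpace.norm_sq_eq, Fin.sum_univ_succ, Fin.sum_univ_succ]
    simp only [circlePoint, Real.norm_eq_abs, sq_abs]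
    simp
    field_simp
    ring
  nlinarith [norm_nonneg (circlePoint (m + 2) t)]

/-! ### Encoding a real sequence in a spiral and decoding parameters. -/

namespace CircleCode

open RatIndex

/-- An index of the first coordinate of `(1 + 2⁻¹ ^ s) • circlePoint n t`, `t` having index `a`. -/
def xIndex (s a : ℕ) : ℕ :=
  mul (mul (add (mk 1 0 1) (twoInvPow s)) (sub (mk 1 0 1) (sq a))) (inv (add (mk 1 0 1) (sq a)))

/-- An index of the second coordinate of `(1 + 2⁻¹ ^ s) • circlePoint n t`, `t` having index `a`. -/
def yIndex (s a : ℕ) : ℕ :=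
  mul (mul (add (mk 1 0 1) (twoInvPow s)) (add a a)) (inv (add (mk 1 0 1) (sq a)))

/-- An index of the vector `(1 + 2⁻¹ ^ s) • circlePoint n t`, `t` having index `a`. -/
def pointIndex (s a : ℕ) : ℕ := Encodable.encode [xIndex s a, yIndex s a]

theorem ratEnum_one : ratEnum (mk 1 0 1) = 1 := by
  rw [ratEnum_mk _ _ one_pos]
  norm_num

theorem ratEnum_inv_one_add_sq (a : ℕ) :
    ratEnum (inv (add (mk 1 0 1) (sq a))) = (1 + ratEnum a ^ 2)⁻¹ := by
  have h : ratEnum (add (mk 1 0 1) (sq a)) = 1 + ratEnum a ^ 2 := by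
    rw [ratEnum_add, ratEnum_sq, ratEnum_one]
  rw [ratEnum_inv (by rw [h]; positivity), h]

theorem ratVecEnum_pointIndex (n s a : ℕ) :
    ratVecEnum n (pointIndex s a) = (1 + (2⁻¹ : ℝ) ^ s) • circlePoint n (ratEnum a) := by
  ext i
  rw [ratVecEnum_apply, PiLp.smul_apply, circlePoint, PiLp.toLp_apply]
  simp only [coord, pointIndex, Denumerable.ofNat_encode, smul_eq_mul]
  obtain ⟨i, hi⟩ := i
  match i with
  | 0 =>
    simp only [List.getD_cons_zero, if_true, xIndex, ratEnum_mul, ratEnum_add, ratEnum_sub,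
      ratEnum_sq, ratEnum_one, ratEnum_twoInvPow, ratEnum_inv_one_add_sq]
    push_cast
    ring
  | 1 =>
    simp only [List.getD_cons_zero, List.getD_cons_succ, one_ne_zero, if_false, if_true, yIndex,
      ratEnum_mul, ratEnum_add, ratEnum_one, ratEnum_twoInvPow, ratEnum_inv_one_add_sq]
    push_cast
    ring
  | i + 2 => simp [ratEnum_zero]

theorem primrec_pointIndex : Primrec₂ pointIndex := by
  have h1 (c : ℕ) : Primrec fun v : ℕ × ℕ => add c (twoInvPow v.1) :=
    primrec_add.comp (.const c) (primrec_twoInvPow.comp .fst)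
  have h2 : Primrec fun v : ℕ × ℕ => sq v.2 := primrec_sq.comp .snd
  have h3 (c : ℕ) : Primrec fun v : ℕ × ℕ => inv (add c (sq v.2)) :=
    primrec_inv.comp (primrec_add.comp (.const c) h2)
  have h4 (c : ℕ) : Primrec fun v : ℕ × ℕ => sub c (sq v.2) := primrec_sub.comp (.const c) h2
  have hx : Primrec fun v : ℕ × ℕ => xIndex v.1 v.2 :=
    primrec_mul.comp (primrec_mul.comp (h1 _) (h4 _)) (h3 _)
  have hy : Primrec fun v : ℕ × ℕ => yIndex v.1 v.2 :=
    primrec_mul.comp (primrec_mul.comp (h1 _) (primrec_add.comp .snd .snd)) (h3 _)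
  exact Primrec.encode.comp (Primrec.list_cons.comp hx (Primrec.list_cons.comp hy (.const [])))

/-- The entry of an enumeration that is to list the basic ball with index `b` if it contains the
`j`-th rational vector. -/
def ballEntry (n j b : ℕ) : ℕ :=
  if lt (distSq n j b.unpair.1) (sq (ofNonneg b.unpair.2)) = true then b + 1 else 0

theorem ballEntry_eq_iff (n j b k : ℕ) :
    ballEntry n j b = k + 1 ↔ b = k ∧ ratVecEnum n j ∈ basicBall (ratVecEnum n) k := by
  have h : lt (distSq n j b.unpair.1) (sq (ofNonneg b.unpair.2)) = true ↔
      ratVecEnum n j ∈ basicBall (ratVecEnum n) b := by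
    rw [lt_iff, ← Rat.cast_lt (K := ℝ), ratEnum_distSq, ratEnum_sq, ratEnum_ofNonneg, basicBall,
      Metric.mem_ball]
    push_cast
    exact pow_lt_pow_iff_left₀ dist_nonneg (nonnegRatEnum_nonneg _) two_ne_zero
  unfold ballEntry
  split_ifs with hb
  · rw [h] at hb
    constructor
    · intro hk
      obtain rfl : b = k := by omega
      exact ⟨rfl, hb⟩
    · rintro ⟨rfl, -⟩
      rfl
  · rw [h] at hb
    constructor
    · intro hk
      exact hk.elim
    · rintro ⟨rfl, hk⟩
      exact absurd hk hb

theorem primrec_ballEntry (n : ℕ) : Primrec₂ (ballEntry n) := by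
  have hb1 : Primrec fun v : ℕ × ℕ => v.2.unpair.1 :=
    Primrec.fst.comp (Primrec.unpair.comp .snd)
  have hb2 : Primrec fun v : ℕ × ℕ => v.2.unpair.2 :=
    Primrec.snd.comp (Primrec.unpair.comp .snd)
  exact Primrec.ite (Primrec.eq.comp (primrec_lt.comp ((primrec_distSq n).comp .fst hb1)
    (primrec_sq.comp (primrec_ofNonneg.comp hb2))) (.const true)) (Primrec.succ.comp .snd) (.const 0)

/-- From a name of a real sequence, a name of the origin and of the closure of a sequence of points
that approach the unit circle. -/
def encoder (n : ℕ) (p : Baire) (k : ℕ) : ℕ :=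
  if k % 2 = 0 then 0
  else ballEntry n (pointIndex (k / 2).unpair.1 (p (Nat.pair (k / 2).unpair.1 (k / 2).unpair.1)))
    (k / 2).unpair.2

theorem recursiveFunctional_encoder (n : ℕ) :
    RecursiveFunctional fun p k => Part.some (encoder n p k) := by
  have hs : Primrec fun k : ℕ => (k / 2).unpair.1 :=
    Primrec.fst.comp (Primrec.unpair.comp (Primrec.nat_div.comp .id (.const 2)))
  have hb : Primrec fun k : ℕ => (k / 2).unpair.2 :=
    Primrec.snd.comp (Primrec.unpair.comp (Primrec.nat_div.comp .id (.const 2)))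
  refine RecursiveFunctional.query (b := fun k => Nat.pair (k / 2).unpair.1 (k / 2).unpair.1)
    (f := fun k a => if k % 2 = 0 then 0 else
      ballEntry n (pointIndex (k / 2).unpair.1 a) (k / 2).unpair.2)
    (Primrec₂.natPair.comp hs hs).to_comp (Primrec.to_comp ?_)
  exact Primrec.ite (Primrec.eq.comp (Primrec.nat_mod.comp .fst (.const 2)) (.const 0)) (.const 0)
    ((primrec_ballEntry n).comp (primrec_pointIndex.comp (hs.comp .fst) .snd) (hb.comp .fst))

/-- The points whose closure is given by `encoder`. -/
noncomputable def spiral (n : ℕ) (p : Baire) (s : ℕ) : EuclideanSpace ℝ (Fin n) :=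
  (1 + (2⁻¹ : ℝ) ^ s) • circlePoint n (ratEnum (p (Nat.pair s s)))

theorem ratVecEnum_zero (n : ℕ) : ratVecEnum n 0 = 0 := by
  ext i
  have h : Denumerable.ofNat (List ℕ) 0 = [] := by
    rw [← Denumerable.ofNat_encode ([] : List ℕ)]
    rfl
  rw [ratVecEnum_apply, coord, h]
  simp [ratEnum_zero]

/-- An open ball meets the closure exactly when it meets the sequence itself, which is decidable for
each rational point. The pairs of a point and a ball are run through at the odd places; the constant
`0` at the even places names the origin. -/
theorem names_encoder (n : ℕ) (p : Baire) :
    (projPos n).source.Names (encoder n p)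
      (0, ⟨closure (Set.range (spiral n p)), isClosed_closure⟩) := by
  constructor
  · have h : (fun i => encoder n p (2 * i)) = fun _ => 0 := by
      funext i
      simp [encoder]
    dsimp only
    rw [h]
    refine ⟨fun i j _ => ?_, ?_⟩
    · rw [dist_self]
      positivity
    · simp only [ratVecEnum_zero]
      exact tendsto_const_nhds
  · have h : (fun i => encoder n p (2 * i + 1)) = fun i =>
        ballEntry n (pointIndex i.unpair.1 (p (Nat.pair i.unpair.1 i.unpair.1))) i.unpair.2 := by
      funext i
      have h1 : (2 * i + 1) % 2 = 1 := by omega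
      have h2 : (2 * i + 1) / 2 = i := by omega
      simp [encoder, h1, h2]
    dsimp only
    rw [h]
    intro k
    have hopen : IsOpen (basicBall (ratVecEnum n) k) := Metric.isOpen_ball
    change _ ↔ (basicBall (ratVecEnum n) k ∩ closure (Set.range (spiral n p))).Nonempty
    rw [Set.inter_comm, closure_inter_open_nonempty_iff hopen]
    simp only [ballEntry_eq_iff, ratVecEnum_pointIndex]
    constructor
    · rintro ⟨i, -, hi⟩
      exact ⟨_, Set.mem_range_self i.unpair.1, hi⟩
    · rintro ⟨_, ⟨s, rfl⟩, hs⟩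
      refine ⟨Nat.pair s k, ?_⟩
      simpa [spiral] using hs

theorem norm_spiral {n : ℕ} (hn : 2 ≤ n) (p : Baire) (s : ℕ) :
    ‖spiral n p s‖ = 1 + 2⁻¹ ^ s := by
  rw [spiral, norm_smul, norm_circlePoint hn, mul_one, Real.norm_of_nonneg (by positivity)]

/-- The points of the closure of `spiral` nearest to the origin are the points on the unit circle
that correspond to cluster points of the given sequence. -/
theorem exists_circlePoint_eq {n : ℕ} (hn : 2 ≤ n) {p : Baire} {a : ℕ → ℝ}
    (hp : realRep.seq.Names p a) (ha : IsCompact (closure (Set.range a)))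
    {y : EuclideanSpace ℝ (Fin n)} (hy : y ∈ closure (Set.range (spiral n p)))
    (hmin : dist 0 y = Metric.infDist 0 (closure (Set.range (spiral n p)))) :
    ∃ T, y = circlePoint n T ∧ MapClusterPt T atTop a := by
  have hpow : Tendsto (fun s : ℕ => (2⁻¹ : ℝ) ^ s) atTop (𝓝 0) :=
    tendsto_pow_atTop_nhds_zero_of_lt_one (by norm_num) (by norm_num)
  have hle : ∀ s, ‖y‖ ≤ 1 + 2⁻¹ ^ s := fun s => by
    rw [← norm_spiral hn p s, ← dist_zero_left y, ← dist_zero_left (spiral n p s), hmin]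
    exact Metric.infDist_le_dist_of_mem (subset_closure (Set.mem_range_self s))
  have hy1 : ‖y‖ ≤ 1 := by
    refine ge_of_tendsto' (x := atTop) (f := fun s : ℕ => 1 + (2⁻¹ : ℝ) ^ s) ?_ hle
    simpa using hpow.const_add 1
  -- Every term has norm greater than one, so `y` is not a term.
  have hcl : MapClusterPt y atTop (spiral n p) := by
    refine mapClusterPt_of_mem_closure_range hy fun s hs => ?_
    have h1 := norm_spiral hn p s
    have h2 : (0 : ℝ) < 2⁻¹ ^ s := by positivity
    rw [hs] at h1
    linarith
  obtain ⟨φ, hφ, hlim⟩ := hcl.tendsto_subseq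
  -- Compactness keeps the parameters from escaping to infinity, where the circle points would tend
  -- to the point `(-1, 0)` that has no parameter.
  obtain ⟨T, -, ψ, hψ, hT⟩ := ha.tendsto_subseq (x := a ∘ φ)
    fun s => subset_closure (Set.mem_range_self _)
  have hsub : Tendsto (φ ∘ ψ) atTop atTop := hφ.tendsto_atTop.comp hψ.tendsto_atTop
  have ht : Tendsto (fun s => (ratEnum (p (Nat.pair s s)) : ℝ) - a s) atTop (𝓝 0) := by
    refine squeeze_zero_norm (fun s => ?_) hpow
    rw [← dist_eq_norm]
    exact BaireRep.cauchy_dist_le (hp s) s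
  have hT' : Tendsto (fun s => (ratEnum (p (Nat.pair ((φ ∘ ψ) s) ((φ ∘ ψ) s))) : ℝ)) atTop
      (𝓝 T) := by
    have h := (ht.comp hsub).add hT
    rw [zero_add] at h
    refine h.congr fun s => ?_
    simp
  refine ⟨T, ?_, ?_⟩
  · have h1 : Tendsto (fun s => 1 + (2⁻¹ : ℝ) ^ ((φ ∘ ψ) s)) atTop (𝓝 1) := by
      simpa using (hpow.comp hsub).const_add 1
    have h2 := h1.smul (((continuous_circlePoint n).tendsto T).comp hT')
    rw [one_smul] at h2
    exact tendsto_nhds_unique (hlim.comp hψ.tendsto_atTop) h2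
  · exact MapClusterPt.of_comp hsub hT.mapClusterPt

/-- Test whether the rational number `t` with index `w.unpair.1` is within `2⁻¹ ^ (i + 1)` of the
parameter of a point on the circle, given by an approximation `a` with error at most
`2⁻¹ ^ w.unpair.2`. -/
def paramTest (i w a : ℕ) : Bool :=
  lt (add (sub (mul w.unpair.1 (add (mk 1 0 1) (coord 0 a))) (coord 1 a))
      (mul (add (sq w.unpair.1) (mk 3 0 1)) (twoInvPow w.unpair.2)))
    (mul (twoInvPow (i + 1)) (add (mk 1 0 1) (coord 0 a))) &&
  lt (add (sub (coord 1 a) (mul w.unpair.1 (add (mk 1 0 1) (coord 0 a))))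
      (mul (add (sq w.unpair.1) (mk 3 0 1)) (twoInvPow w.unpair.2)))
    (mul (twoInvPow (i + 1)) (add (mk 1 0 1) (coord 0 a)))

/-- Multiplying by `1 + x` avoids division by an approximation. With error `δ`, the term `(t² + 3)δ`
covers `(t² + 1)δ` for `t * x`, since `|t| ≤ t² + 1`, one `δ` for `y`, and one for `x` on the right,
since `2⁻¹ ^ (i + 1) ≤ 1`. -/
theorem paramTest_iff (i w a : ℕ) :
    paramTest i w a ↔
      |(ratEnum w.unpair.1 : ℝ) * (1 + ratEnum (coord 0 a)) - ratEnum (coord 1 a)| +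
        ((ratEnum w.unpair.1 : ℝ) ^ 2 + 3) * 2⁻¹ ^ w.unpair.2 <
          2⁻¹ ^ (i + 1) * (1 + ratEnum (coord 0 a)) := by
  have h3 : ratEnum (mk 3 0 1) = 3 := by
    rw [ratEnum_mk _ _ one_pos]
    norm_num
  simp only [paramTest, Bool.and_eq_true, lt_iff, ← Rat.cast_lt (K := ℝ), ratEnum_add, ratEnum_sub,
    ratEnum_mul, ratEnum_sq, ratEnum_twoInvPow, ratEnum_one, h3]
  push_cast
  rw [← lt_sub_iff_add_lt (a := |_|), abs_lt]
  constructor <;> rintro ⟨h1, h2⟩ <;> constructor <;> linarith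

theorem primrec_paramTest : Primrec fun v : ℕ × ℕ × ℕ => paramTest v.1 v.2.1 v.2.2 := by
  have ht : Primrec fun v : ℕ × ℕ × ℕ => v.2.1.unpair.1 :=
    Primrec.fst.comp (Primrec.unpair.comp (Primrec.fst.comp .snd))
  have hm : Primrec fun v : ℕ × ℕ × ℕ => twoInvPow v.2.1.unpair.2 :=
    primrec_twoInvPow.comp (Primrec.snd.comp (Primrec.unpair.comp (Primrec.fst.comp .snd)))
  have hx (c : ℕ) : Primrec fun v : ℕ × ℕ × ℕ => add c (coord 0 v.2.2) :=
    primrec_add.comp (.const c) ((primrec_coord 0).comp (Primrec.snd.comp .snd))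
  have hy : Primrec fun v : ℕ × ℕ × ℕ => coord 1 v.2.2 :=
    (primrec_coord 1).comp (Primrec.snd.comp .snd)
  have herr (c : ℕ) : Primrec fun v : ℕ × ℕ × ℕ =>
      mul (add (sq v.2.1.unpair.1) c) (twoInvPow v.2.1.unpair.2) :=
    primrec_mul.comp (primrec_add.comp (primrec_sq.comp ht) (.const c)) hm
  have hi : Primrec fun v : ℕ × ℕ × ℕ => twoInvPow (v.1 + 1) :=
    primrec_twoInvPow.comp (Primrec.succ.comp .fst)
  have hr (c : ℕ) := primrec_mul.comp hi (hx c)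
  have htx (c : ℕ) := primrec_mul.comp ht (hx c)
  exact Primrec.and.comp
    (primrec_lt.comp (primrec_add.comp (primrec_sub.comp (htx _) hy) (herr _)) (hr _))
    (primrec_lt.comp (primrec_add.comp (primrec_sub.comp hy (htx _)) (herr _)) (hr _))

/-- The functional that computes the parameter of a point on the circle. -/
def decoder (r : Baire) (i : ℕ) : Part ℕ :=
  (Nat.rfind fun w => Part.some (paramTest i w (r w.unpair.2))).map fun w => w.unpair.1

theorem recursiveFunctional_decoder : RecursiveFunctional fun r i => decoder r i :=
  RecursiveFunctional.search (b := fun w => w.unpair.2) (g := fun _ w => w.unpair.1)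
    (Primrec.snd.comp .unpair).to_comp primrec_paramTest.to_comp
    (Primrec.to_comp (Primrec.fst.comp (Primrec.unpair.comp .snd)))

theorem exists_mem_decoder {n : ℕ} (hn : 2 ≤ n) {r : Baire} {T : ℝ}
    (hr : (euclideanRep n).Names r (circlePoint n T)) (i : ℕ) :
    ∃ v ∈ decoder r i, dist (ratEnum v : ℝ) T ≤ 2⁻¹ ^ (i + 1) := by
  set X : ℝ := (1 - T ^ 2) / (1 + T ^ 2) with hX
  set Y : ℝ := 2 * T / (1 + T ^ 2) with hY
  have hpos := one_add_sq_pos T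
  -- The parametrization omits `(-1, 0)`, so `T = Y / (1 + X)` makes sense.
  have hX1 : 0 < 1 + X := by
    have : 1 + X = 2 / (1 + T ^ 2) := by rw [hX]; field_simp; ring
    rw [this]
    positivity
  have hYX : Y = T * (1 + X) := by rw [hX, hY]; field_simp; ring
  have hcoord : ∀ m (k : Fin n), |(ratEnum (coord k (r m)) : ℝ) - circlePoint n T k| ≤ 2⁻¹ ^ m := by
    intro m k
    refine le_trans ?_ (BaireRep.cauchy_dist_le hr m)
    rw [dist_eq_norm]
    exact PiLp.norm_apply_le (ratVecEnum n (r m) - circlePoint n T) k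
  have hx : ∀ m, |(ratEnum (coord 0 (r m)) : ℝ) - X| ≤ 2⁻¹ ^ m := fun m => by
    simpa [circlePoint] using hcoord m ⟨0, by omega⟩
  have hy : ∀ m, |(ratEnum (coord 1 (r m)) : ℝ) - Y| ≤ 2⁻¹ ^ m := fun m => by
    simpa [circlePoint] using hcoord m ⟨1, by omega⟩
  have hpow : Tendsto (fun s : ℕ => (2⁻¹ : ℝ) ^ s) atTop (𝓝 0) :=
    tendsto_pow_atTop_nhds_zero_of_lt_one (by norm_num) (by norm_num)
  have hdom : ∃ w, paramTest i w (r w.unpair.2) := by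
    -- For a rational `t` strictly within the tolerance of `T`, the test inequality holds in the
    -- limit, hence at some finite precision `m`.
    obtain ⟨j, hj⟩ := denseRange_ratEnum.exists_dist_lt T
      (by positivity : (0 : ℝ) < 2⁻¹ ^ (i + 1))
    rw [dist_comm, Real.dist_eq] at hj
    have hxl : Tendsto (fun m => (ratEnum (coord 0 (r m)) : ℝ)) atTop (𝓝 X) :=
      tendsto_iff_norm_sub_tendsto_zero.2 (squeeze_zero (fun _ => norm_nonneg _) hx hpow)
    have hyl : Tendsto (fun m => (ratEnum (coord 1 (r m)) : ℝ)) atTop (𝓝 Y) :=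
      tendsto_iff_norm_sub_tendsto_zero.2 (squeeze_zero (fun _ => norm_nonneg _) hy hpow)
    have hl := ((((hxl.const_add 1).const_mul (ratEnum j : ℝ)).sub hyl).abs).add
      (hpow.const_mul ((ratEnum j : ℝ) ^ 2 + 3))
    have hrr := (hxl.const_add 1).const_mul ((2⁻¹ : ℝ) ^ (i + 1))
    obtain ⟨m, hm⟩ := (hl.eventually_lt hrr (by
      rw [mul_zero, add_zero, hYX, ← sub_mul, abs_mul, abs_of_pos hX1]
      exact mul_lt_mul_of_pos_right hj hX1)).exists
    exact ⟨Nat.pair j m, (paramTest_iff _ _ _).2 (by simpa using hm)⟩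
  obtain ⟨w₀, hw₀⟩ := hdom
  obtain ⟨w, hw, -⟩ := Nat.rfind_min' (p := fun w => paramTest i w (r w.unpair.2)) hw₀
  refine ⟨_, (Part.mem_map_iff _).2 ⟨w, hw, rfl⟩, ?_⟩
  have htest : paramTest i w (r w.unpair.2) = true :=
    (Part.mem_some_iff.1 (Nat.rfind_spec hw)).symm
  have h := (paramTest_iff _ _ _).1 htest
  have hxm := hx w.unpair.2
  have hym := hy w.unpair.2
  generalize (ratEnum w.unpair.1 : ℝ) = t at h ⊢
  generalize (ratEnum (coord 0 (r w.unpair.2)) : ℝ) = x at h hxm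
  generalize (ratEnum (coord 1 (r w.unpair.2)) : ℝ) = y at h hym
  have hδ : (0 : ℝ) < 2⁻¹ ^ w.unpair.2 := by positivity
  generalize (2⁻¹ : ℝ) ^ w.unpair.2 = δ at h hxm hym hδ
  have hη : (0 : ℝ) < 2⁻¹ ^ (i + 1) := by positivity
  have hη1 : (2⁻¹ : ℝ) ^ (i + 1) ≤ 1 := pow_le_one₀ (by norm_num) (by norm_num)
  generalize (2⁻¹ : ℝ) ^ (i + 1) = η at h hη hη1 ⊢
  have ht : |t| ≤ t ^ 2 + 1 := by
    rw [abs_le]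
    constructor <;> nlinarith [sq_nonneg (t + 1), sq_nonneg (t - 1)]
  have h1 : |(t - T) * (1 + X)| ≤ |t * (1 + x) - y| + (t ^ 2 + 2) * δ := by
    have e : (t - T) * (1 + X) = (t * (1 + x) - y) + (-(t * (x - X)) + (y - Y)) := by
      rw [hYX]; ring
    have h2 : |t * (x - X)| ≤ (t ^ 2 + 1) * δ := by
      rw [abs_mul]
      exact mul_le_mul ht hxm (abs_nonneg _) (by positivity)
    have h3 := abs_add_le (t * (1 + x) - y) (-(t * (x - X)) + (y - Y))
    have h4 := abs_add_le (-(t * (x - X))) (y - Y)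
    rw [abs_neg] at h4
    rw [e]
    linarith
  have h5 : η * (1 + x) ≤ η * (1 + X) + δ := by
    have := (abs_le.1 hxm).2
    nlinarith
  rw [abs_mul, abs_of_pos hX1] at h1
  rw [Real.dist_eq]
  refine le_of_mul_le_mul_right ?_ hX1
  linarith

end CircleCode

theorem bwtReal_strongReducible_projPos {n : ℕ} (hn : 2 ≤ n) :
    MultiFunction.StrongReducible bwtReal (projPos n) := by
  refine .of_functional (CircleCode.recursiveFunctional_encoder n)
    CircleCode.recursiveFunctional_decoder fun p a hp ha => ?_
  obtain ⟨-, hcomp, -⟩ := ha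
  refine ⟨_, ?_, CircleCode.names_encoder n p, fun y hy r hr => ?_⟩
  · have hne : (closure (Set.range (CircleCode.spiral n p))).Nonempty :=
      (Set.range_nonempty _).closure
    -- A nearest point exists because `ℝⁿ` is proper.
    obtain ⟨y, hy, hd⟩ := isClosed_closure.exists_infDist_eq_dist hne 0
    exact ⟨y, hy, hd.symm⟩
  · obtain ⟨T, rfl, hT⟩ := CircleCode.exists_circlePoint_eq hn hp hcomp hy.1 hy.2
    choose q hq hqT using CircleCode.exists_mem_decoder hn hr
    exact ⟨q, T, hq, ⟨hcomp, hT⟩, BaireRep.cauchy_names_of_dist_le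
      (α := fun k => (ratEnum k : ℝ)) (hα := denseRange_ratEnum) hqT⟩

theorem mainTheorem3 (n : ℕ) (hn : 2 ≤ n) :
    MultiFunction.StrongEquiv (projPos n) bwtReal :=
  ⟨projPos_strongReducible_bwtReal n, bwtReal_strongReducible_projPos hn⟩
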